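/- Let $n,p$ be integers with $n-p-1>0$, let $\gamma$ be a real number with $0\le\gamma<p^2+p$, and let $\|\cdot\|_{\mathrm F}$ be the Frobenius norm on $\mathbb R^{n\times p}$. For $N\ge 1$ and $M\in\mathbb R^{n\times p}$ let $Y\sim \mathrm N_{n,p}(M,I_n,N^{-1}I_p)$, i.e. the entries of $Y$ are independent with $Y_{ai}\sim \mathrm N(M_{ai},1/N)$ (the average of $N$ independent observations with unit variance); write $p_N(Y\mid M)$ for the density of $Y$ and $\mathrm E_M$ for the expectation. Consider the improper prior densities $$\pi_{\mathrm{SVS}}(M)=\det(M^\top M)^{-(n-p-1)/2},\qquad \pi_{\mathrm{MSVS1}}(M)=\pi_{\mathrm{SVS}}(M)\,\|M\|_{\mathrm F}^{-\gamma},$$ and let $\hat M_{\mathrm{SVS}}$ and $\hat M_{\mathrm{MSVS1}}$ be the corresponding generalized Bayes estimators under the Frobenius loss $\|\hat M-M\|_{\mathrm F}^2$, i.e. the posterior means $$\hat M_\pi(Y)=\frac{\int M\,p_N(Y\mid M)\,\pi(M)\,\mathrm dM}{\int p_N(Y\mid M)\,\pi(M)\,\mathrm dM}.$$ These estimators are well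 defined for every $N\ge1$ and every $Y$. For every $M\in\mathbb R^{n\times p}$ of full column rank (equivalently $\det(M^\top M)\ne0$) their risks are finite for every $N\ge 1$, and $$N^2\left(\mathrm E_M\big[\|\hat M_{\mathrm{MSVS1}}-M\|_{\mathrm F}^2\big]-\mathrm E_M\big[\|\hat M_{\mathrm{SVS}}-M\|_{\mathrm F}^2\big]\right)\to\frac{\gamma(\gamma-2p^2-2p+4)}{\mathrm{tr}(M^\top M)}\qquad(N\to\infty).$$ Therefore, if $p\ge2$ and $0<\gamma<p^2+p$, then $\hat M_{\mathrm{MSVS1}}$ asymptotically dominates $\hat M_{\mathrm{SVS}}$ under the Frobenius loss: at every $M$ of full column rank, $N^2$ times the risk difference (MSVS1 minus SVS) has a strictly negative limit, so that the risk of $\hat M_{\mathrm{MSVS1}}$ is strictly smaller for all large $N$. -/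

import Mathlib

open MeasureTheory Filter Topology
open scoped Matrix ENNReal

noncomputable section

namespace DoubleShrinkage

/-- The space of real `n × p` matrices, vectorized: its norm is the Frobenius norm
`‖M‖ = (∑ (a, i), M (a, i) ^ 2) ^ (1 / 2)` and its `volume` is the Lebesgue measure. -/
abbrev MatSpace (n p : ℕ) : Type := EuclideanSpace ℝ (Fin n × Fin p)

/-- The matrix with entries `M (a, i)`. -/
def toMat {n p : ℕ} (M : MatSpace n p) : Matrix (Fin n) (Fin p) ℝ :=
  Matrix.of fun a i => M (a, i)

/-- The Gram matrix `Mᵀ M`. -/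
def gram {n p : ℕ} (M : MatSpace n p) : Matrix (Fin p) (Fin p) ℝ :=
  (toMat M)ᵀ * toMat M

/-- The density at `Y` of the law `N(M, I_n, N⁻¹ I_p)` of the average of `N` independent
observations: the entries are independent, with means `M (a, i)` and variance `1 / N`. -/
def normalDensity {n p : ℕ} (N : ℕ) (Y M : MatSpace n p) : ℝ :=
  ((N : ℝ) / (2 * Real.pi)) ^ (((n * p : ℕ) : ℝ) / 2) *
    Real.exp (-((N : ℝ) / 2) * ‖Y - M‖ ^ 2)

/-- The law `N(M, I_n, N⁻¹ I_p)`. -/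
def normalLaw {n p : ℕ} (N : ℕ) (M : MatSpace n p) : Measure (MatSpace n p) :=
  volume.withDensity fun Y => ENNReal.ofReal (normalDensity N Y M)

/-- The singular value shrinkage prior `det (Mᵀ M) ^ (-(n - p - 1) / 2)`. -/
def priorSVS {n p : ℕ} (M : MatSpace n p) : ℝ :=
  (gram M).det ^ (-((n : ℝ) - (p : ℝ) - 1) / 2)

/-- The modified prior, with additional scalar shrinkage `‖M‖_F ^ (-γ)`. -/
def priorMSVS1 {n p : ℕ} (γ : ℝ) (M : MatSpace n p) : ℝ :=
  priorSVS M * ‖M‖ ^ (-γ)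

/-- The marginal density of `Y` under the (possibly improper) prior density `π`. -/
def marginal {n p : ℕ} (N : ℕ) (π : MatSpace n p → ℝ) (Y : MatSpace n p) : ℝ :=
  ∫ M, normalDensity N Y M * π M

/-- The generalized Bayes estimator under the squared Frobenius loss: the posterior mean of `M`
given `Y`, for the prior density `π`. -/
def bayesEstimator {n p : ℕ} (N : ℕ) (π : MatSpace n p → ℝ) (Y : MatSpace n p) : MatSpace n p :=
  (marginal N π Y)⁻¹ • ∫ M, (normalDensity N Y M * π M) • M

/-- The posterior mean exists at every `Y`: the marginal density is positive and finite, and the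
posterior has a first moment. -/
def BayesWellDefined {n p : ℕ} (N : ℕ) (π : MatSpace n p → ℝ) : Prop :=
  ∀ Y : MatSpace n p,
    Integrable (fun M => normalDensity N Y M * π M) ∧
    0 < marginal N π Y ∧
    Integrable (fun M => (normalDensity N Y M * π M) • M)

/-- The Frobenius risk `E_M ‖δ(Y) - M‖_F ^ 2`, where `Y ∼ N(M, I_n, N⁻¹ I_p)`. -/
def risk {n p : ℕ} (N : ℕ) (δ : MatSpace n p → MatSpace n p) (M : MatSpace n p) : ℝ :=
  ∫ Y, ‖δ Y - M‖ ^ 2 ∂(normalLaw N M)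

/-- The squared Frobenius error has a finite expectation. -/
def FiniteRisk {n p : ℕ} (N : ℕ) (δ : MatSpace n p → MatSpace n p) (M : MatSpace n p) : Prop :=
  Integrable (fun Y => ‖δ Y - M‖ ^ 2) (normalLaw N M)

/-- The matrices of full column rank. -/
def fullRank (n p : ℕ) : Set (MatSpace n p) := {M | (toMat M).rank = p}

/-- The sequence of estimators `δ₁` asymptotically dominates `δ₂` on `S`: at every `M` in `S`,
the risk difference is negative in the leading term, of order `N⁻²`
(so that the risk of `δ₁ N` at `M` is smaller than that of `δ₂ N` for all large `N`). -/
def AsymptoticallyDominates {n p : ℕ} (δ₁ δ₂ : ℕ → MatSpace n p → MatSpace n p)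
    (S : Set (MatSpace n p)) : Prop :=
  ∀ M ∈ S, ∃ L : ℝ, L < 0 ∧
    Tendsto (fun N : ℕ => (N : ℝ) ^ 2 * (risk N (δ₁ N) M - risk N (δ₂ N) M)) atTop (𝓝 L)

end DoubleShrinkage

end

/-!
# Asymptotic comparison of singular value shrinkage with an added scalar shrinkage

For a prior density `π`, the posterior mean is `Y + N⁻¹ g_N(Y)`, where the score `g_N` is the
logarithmic gradient of the marginal density (`bayesEstimator_eq`). As `N → ∞` the score tends to
`∇ log π`, and expanding the square in the risk gives
`N² (risk - np / N) → 2 Δ log π (M) + ‖∇ log π (M)‖²` wherever `π` is smooth and positive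
(`tendsto_risk`). For the two priors at hand `∇ log π_MSVS1 = ∇ log π_SVS - γ M / ‖M‖²`, so in the
difference of the two limits the Laplacian of `log π_SVS` cancels, and the cross term
`⟨∇ log π_SVS, M⟩ = -p (n - p - 1)` is known from the homogeneity of `π_SVS`
(`inner_gradLogSVS`). What is left is the stated constant.

Three estimates carry the argument.

* The priors are integrable against a Gaussian (`integrable_priorMSVS1_mul_exp`). The Gram
  determinant of the columns is a product of squared distances, each from a column to the span of
  those already treated. Sharing `‖M‖ ^ (-γ)` equally among the columns and integrating one column
  at a time, the weighted arithmetic-geometric mean inequality reduces everything to integrals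
  `∫ |t| ^ s * exp (-c t²)` with `s > -1`. The condition `γ < p² + p` is what leaves room for such
  exponents.
* For all `Y` and `N` the score is bounded by a polynomial in `N` and `‖Y‖`
  (`exists_norm_postScore_le`): Jensen's inequality bounds a posterior second moment by the
  logarithm of a ratio of two marginals, and that logarithm grows only polynomially.
* Near a point where the prior is smooth and positive, `‖g_N - ∇ log π‖ = O(1 / N)` uniformly
  (`exists_postScore_sub_le`), by a symmetrized Taylor expansion. The error `O(1 / N)` is
  `o(N ^ (-1 / 2))`, which the term of the risk that is linear in the score needs, and it makes it
  unnecessary to differentiate the marginal density.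

With `Y = M + x / √N` and `x` standard normal, the limit of the risk is then a single application
of dominated convergence: on `‖x‖ ≥ r √N` any power of `N` is at most a polynomial in `‖x‖`, so the
global bound is sufficient there.
-/

noncomputable section

namespace DoubleShrinkage

/-! ### Integrability of negative powers of Gram determinants -/

section

theorem integrable_abs_rpow_mul_exp_neg_mul_sq {b s : ℝ} (hb : 0 < b) (hs : -1 < s) :
    Integrable fun x : ℝ => |x| ^ s * Real.exp (-b * x ^ 2) := by
  have hpos : IntegrableOn (fun x : ℝ => |x| ^ s * Real.exp (-b * x ^ 2)) (Set.Ioi 0) := by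
    refine ((integrable_rpow_mul_exp_neg_mul_sq hb hs).integrableOn (s := Set.Ioi 0)).congr_fun
      (fun x hx => ?_) measurableSet_Ioi
    simp only [abs_of_pos (Set.mem_Ioi.mp hx)]
  rw [← integrableOn_univ, ← @Set.Iio_union_Ici _ _ (0 : ℝ), integrableOn_union,
    integrableOn_Ici_iff_integrableOn_Ioi]
  refine ⟨?_, hpos⟩
  rw [← (Measure.measurePreserving_neg (volume : Measure ℝ)).integrableOn_comp_preimage
    (Homeomorph.neg ℝ).measurableEmbedding]
  simpa [Function.comp_def] using hpos

/-- The weighted arithmetic-geometric mean inequality in the form in which it bounds negative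
powers of a partial sum of squares by a product over the coordinates. -/
theorem sum_sq_rpow_neg_le_prod {ι : Type*} [Fintype ι] (S : Finset ι) (w y : ι → ℝ)
    (hw : ∀ i, 0 ≤ w i) (hw1 : ∑ i, w i = 1) (hwS : ∀ i ∉ S, w i = 0) (hy : ∀ i, y i ≠ 0)
    {s : ℝ} (hs : 0 ≤ s) :
    (∑ i ∈ S, y i ^ 2) ^ (-s / 2) ≤ ∏ i, |y i| ^ (-s * w i) := by
  have hle1 : ∀ i, w i ≤ 1 := fun i => hw1 ▸
    Finset.single_le_sum (f := w) (fun j _ => hw j) (Finset.mem_univ i)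
  have h1 : ∏ i, (y i ^ 2) ^ w i ≤ ∑ i ∈ S, y i ^ 2 := by
    refine (Real.geom_mean_le_arith_mean_weighted Finset.univ w (fun i => y i ^ 2)
      (fun i _ => hw i) hw1 (fun i _ => sq_nonneg _)).trans ?_
    rw [← Finset.sum_subset (Finset.subset_univ S) (fun i _ hi => by simp [hwS i hi])]
    exact Finset.sum_le_sum fun i _ => mul_le_of_le_one_left (sq_nonneg _) (hle1 i)
  have h0 : 0 < ∏ i, (y i ^ 2) ^ w i :=
    Finset.prod_pos fun i _ => Real.rpow_pos_of_pos (by have := hy i; positivity) _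
  refine (Real.rpow_le_rpow_of_nonpos h0 h1 (by linarith)).trans_eq ?_
  rw [← Real.finsetProd_rpow _ _ (fun i _ => by positivity)]
  refine Finset.prod_congr rfl fun i _ => ?_
  rw [← Real.rpow_mul (by positivity), ← sq_abs, ← Real.rpow_natCast,
    ← Real.rpow_mul (abs_nonneg _)]
  congr 1
  push_cast
  ring

/-- A product of a negative power of a partial sum of squares and a negative power of the norm is
integrable against a Gaussian as soon as each singularity is, and their total degree is less than
the dimension. -/
theorem integrable_partial_norm_rpow_mul {n : ℕ} (S : Finset (Fin n)) {k b c : ℝ} (hk : 0 ≤ k)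
    (hkS : k < S.card) (hb : 0 ≤ b) (hkb : k + b < n) (hc : 0 < c) :
    Integrable fun x : EuclideanSpace ℝ (Fin n) =>
      (∑ i ∈ S, x i ^ 2) ^ (-k / 2) * (‖x‖ ^ (-b) * Real.exp (-c * ‖x‖ ^ 2)) := by
  have hq : (0 : ℝ) < S.card := hk.trans_lt hkS
  have hnk : 0 < (n : ℝ) - k := by linarith
  -- `k` is shared equally among the coordinates in `S`, and `b` in proportion to the room left
  set w : Fin n → ℝ := fun i => if i ∈ S then (S.card : ℝ)⁻¹ else 0 with hw
  set u : Fin n → ℝ := fun i => (1 - k * w i) / (n - k) with hu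
  have hw0 : ∀ i, 0 ≤ w i := fun i => by simp only [hw]; split_ifs <;> positivity
  have hkw : ∀ i, k * w i < 1 := fun i => by
    simp only [hw]
    split_ifs
    · rw [← div_eq_mul_inv, div_lt_one hq]; exact hkS
    · simp
  have hw1 : ∑ i, w i = 1 := by simp [hw, hq.ne']
  have hu0 : ∀ i, 0 ≤ u i := fun i => div_nonneg (by linarith [hkw i]) hnk.le
  have hu1 : ∑ i, u i = 1 := by
    simp only [hu]
    rw [← Finset.sum_div, Finset.sum_sub_distrib, ← Finset.mul_sum, hw1]
    simp [hnk.ne']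
  have hexp : ∀ i, -1 < -k * w i + -b * u i := fun i => by
    have h1 : b * u i < 1 - k * w i := by
      have : b * u i = (1 - k * w i) * (b / (n - k)) := by simp only [hu]; ring
      rw [this]
      refine mul_lt_of_lt_one_right (by linarith [hkw i]) ?_
      rw [div_lt_one hnk]; linarith
    linarith
  have hmain : Integrable fun y : Fin n → ℝ =>
      ∏ i, (|y i| ^ (-k * w i + -b * u i) * Real.exp (-c * y i ^ 2)) :=
    Integrable.fintype_prod (f := fun i t => |t| ^ (-k * w i + -b * u i) * Real.exp (-c * t ^ 2))
      fun i => integrable_abs_rpow_mul_exp_neg_mul_sq hc (hexp i)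
  have hmp := (EuclideanSpace.volume_preserving_symm_measurableEquiv_toLp (Fin n))
  have hint := (hmp.integrable_comp_emb (MeasurableEquiv.measurableEmbedding _)).2 hmain
  refine hint.mono' ?_ ?_
  · refine Measurable.aestronglyMeasurable ?_
    fun_prop
  have hne : ∀ᵐ x : EuclideanSpace ℝ (Fin n), ∀ i, x i ≠ 0 := by
    have h : ∀ᵐ y : Fin n → ℝ, ∀ i, y i ≠ 0 :=
      ae_all_iff.2 fun i => Measure.ae_eval_ne _ i 0
    exact hmp.quasiMeasurePreserving.ae h
  filter_upwards [hne] with x hx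
  rw [Real.norm_of_nonneg (by positivity)]
  have hnorm : ‖x‖ ^ (-b) ≤ ∏ i, |x i| ^ (-b * u i) := by
    have h := sum_sq_rpow_neg_le_prod Finset.univ u (fun i => x i) hu0 hu1 (by simp) hx hb
    rwa [← EuclideanSpace.real_norm_sq_eq, ← Real.rpow_natCast, ← Real.rpow_mul (norm_nonneg _),
      show ((2 : ℕ) : ℝ) * (-b / 2) = -b by push_cast; ring] at h
  have hS := sum_sq_rpow_neg_le_prod S w (fun i => x i) hw0 hw1 (by simp +contextual [hw]) hx hk
  have hE : Real.exp (-c * ‖x‖ ^ 2) = ∏ i, Real.exp (-c * x i ^ 2) := by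
    rw [← Real.exp_sum, EuclideanSpace.real_norm_sq_eq, Finset.mul_sum]
  calc _ ≤ (∏ i, |x i| ^ (-k * w i)) *
        ((∏ i, |x i| ^ (-b * u i)) * ∏ i, Real.exp (-c * x i ^ 2)) := by
        rw [hE]; gcongr
    _ = ∏ i, (|x i| ^ (-k * w i + -b * u i) * Real.exp (-c * x i ^ 2)) := by
        rw [← Finset.prod_mul_distrib, ← Finset.prod_mul_distrib]
        refine Finset.prod_congr rfl fun i _ => ?_
        rw [Real.rpow_add (abs_pos.2 (hx i))]; ring
    _ = _ := rfl

theorem gram_sum_smul {ι F : Type*} [Fintype ι] [NormedAddCommGroup F]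
    [InnerProductSpace ℝ F] (w : ι → F) (T : Matrix ι ι ℝ) :
    Matrix.gram ℝ (fun j => ∑ i, T i j • w i) = Tᵀ * Matrix.gram ℝ w * T := by
  ext i j
  simp only [Matrix.gram_apply, Matrix.mul_apply, Matrix.transpose_apply, sum_inner, inner_sum,
    inner_smul_left, inner_smul_right, Finset.sum_mul]
  refine Finset.sum_congr rfl fun a _ => ?_
  rw [Finset.mul_sum]
  refine Finset.sum_congr rfl fun b _ => ?_
  rw [conj_trivial]
  ring

/-- Adding a vector multiplies the Gram determinant by the squared distance to the span. -/
theorem det_gram_cons_add {j : ℕ} {F : Type*} [NormedAddCommGroup F] [InnerProductSpace ℝ F]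
    (v : Fin j → F) {u y : F} (hu : u ∈ Submodule.span ℝ (Set.range v))
    (hy : y ∈ (Submodule.span ℝ (Set.range v))ᗮ) :
    (Matrix.gram ℝ (Fin.cons (u + y) v : Fin (j + 1) → F)).det =
      (Matrix.gram ℝ v).det * ‖y‖ ^ 2 := by
  obtain ⟨c, rfl⟩ := (Submodule.mem_span_range_iff_exists_fun ℝ).1 hu
  have hyv : ∀ i, inner ℝ y (v i) = 0 := fun i =>
    (Submodule.mem_orthogonal' _ _).1 hy _ (Submodule.subset_span ⟨i, rfl⟩)
  set T : Matrix (Fin (j + 1)) (Fin (j + 1)) ℝ :=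
    Matrix.of (Fin.cons (Fin.cons 1 0) fun i => Fin.cons (c i) (Pi.single i 1)) with hT
  have hTdet : T.det = 1 := by
    rw [Matrix.det_succ_row_zero, Fin.sum_univ_succ]
    have : T.submatrix Fin.succ (Fin.succAbove 0) = 1 := by
      ext a b
      simp [hT, Matrix.one_apply, Pi.single_apply, eq_comm]
    rw [this]
    simp [hT]
  have hcons : (Fin.cons ((∑ i, c i • v i) + y) v : Fin (j + 1) → F) =
      fun a => ∑ b, T b a • (Fin.cons y v : Fin (j + 1) → F) b := by
    funext a
    rw [Fin.sum_univ_succ]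
    refine Fin.cases ?_ (fun a => ?_) a
    · simp [hT, add_comm]
    · simp [hT, Pi.single_apply]
  rw [hcons, gram_sum_smul, Matrix.det_mul, Matrix.det_mul, Matrix.det_transpose, hTdet,
    Matrix.det_succ_row_zero, Fin.sum_univ_succ]
  have : (Matrix.gram ℝ (Fin.cons y v : Fin (j + 1) → F)).submatrix Fin.succ (Fin.succAbove 0) =
      Matrix.gram ℝ v := by
    ext a b
    simp [Matrix.gram_apply]
  rw [this]
  simp [Matrix.gram_apply, hyv, mul_comm]

/-- A family of `j` linearly independent vectors leaves an orthonormal basis whose first `n - j`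
vectors are orthogonal to it. -/
theorem exists_orthonormalBasis_orthogonal {n j : ℕ} {v : Fin j → EuclideanSpace ℝ (Fin n)}
    (hv : LinearIndependent ℝ v) :
    ∃ b : OrthonormalBasis (Fin n) ℝ (EuclideanSpace ℝ (Fin n)),
      ∀ i : Fin n, (i : ℕ) < n - j → b i ∈ (Submodule.span ℝ (Set.range v))ᗮ := by
  set W := (Submodule.span ℝ (Set.range v))ᗮ
  have hdim : Module.finrank ℝ W = n - j := by
    have h := Submodule.finrank_add_finrank_orthogonal (Submodule.span ℝ (Set.range v))
    rw [finrank_span_eq_card hv] at h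
    simp only [Fintype.card_fin, finrank_euclideanSpace] at h
    change j + Module.finrank ℝ W = n at h
    omega
  let e := (stdOrthonormalBasis ℝ W).reindex (finCongr hdim)
  let f : Fin n → EuclideanSpace ℝ (Fin n) := fun i => if h : (i : ℕ) < n - j then e ⟨i, h⟩ else 0
  obtain ⟨b, hb⟩ := Orthonormal.exists_orthonormalBasis_extension_of_card_eq (𝕜 := ℝ)
    (ι := Fin n) (by simp) (v := f) (s := {i | (i : ℕ) < n - j}) (by
      have h1 : Orthonormal ℝ fun i : Fin (n - j) => (e i : EuclideanSpace ℝ (Fin n)) :=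
        e.orthonormal.comp_linearIsometry W.subtypeₗᵢ
      have h2 := h1.comp (fun i : {i : Fin n | (i : ℕ) < n - j} => (⟨i.1, i.2⟩ : Fin (n - j)))
        (fun a b hab => by
          simp only [Fin.mk.injEq] at hab
          exact Subtype.ext (Fin.ext hab))
      convert! h2 using 1
      funext i
      have := i.2
      simp only [Set.mem_ofPred_eq] at this
      simp [f, Set.domRestrict, this])
  refine ⟨b, fun i hi => ?_⟩
  rw [hb i hi]
  simp only [f, hi, dif_pos]
  exact (e _).2

/-- The Gaussian-weighted negative power of the Gram determinant of `j` vectors, with an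
additional singularity at the origin in each of them. -/
def gramWeight {n : ℕ} (k b c : ℝ) {j : ℕ} (v : Fin j → EuclideanSpace ℝ (Fin n)) : ℝ :=
  (Matrix.gram ℝ v).det ^ (-k / 2) * ∏ i, (‖v i‖ ^ (-b) * Real.exp (-c * ‖v i‖ ^ 2))

theorem measurable_gramWeight {n : ℕ} (k b c : ℝ) (j : ℕ) :
    Measurable (gramWeight k b c : (Fin j → EuclideanSpace ℝ (Fin n)) → ℝ) := by
  have : Measurable fun v : Fin j → EuclideanSpace ℝ (Fin n) => (Matrix.gram ℝ v).det := by
    refine Continuous.measurable (Continuous.matrix_det ?_)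
    exact continuous_matrix fun a b => by simp only [Matrix.gram_apply]; fun_prop
  unfold gramWeight
  fun_prop

theorem det_gram_nonneg {ι F : Type*} [Fintype ι] [DecidableEq ι] [NormedAddCommGroup F]
    [InnerProductSpace ℝ F] (v : ι → F) : 0 ≤ (Matrix.gram ℝ v).det :=
  (Matrix.posSemidef_gram ℝ v).det_nonneg

/-- The weight of a family extended by one vector is at most its own weight times a weight of the
new vector that depends on the family only through an orthonormal basis. -/
theorem gramWeight_cons_le {n j : ℕ} {k : ℝ} (hk : 0 < k) (b c : ℝ)
    {v : Fin j → EuclideanSpace ℝ (Fin n)}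
    {B : OrthonormalBasis (Fin n) ℝ (EuclideanSpace ℝ (Fin n))}
    {S : Finset (Fin n)}
    (hB : ∀ i ∈ S, B i ∈ (Submodule.span ℝ (Set.range v))ᗮ)
    (x : EuclideanSpace ℝ (Fin n))
    (hx : ∑ i ∈ S, B.repr x i ^ 2 ≠ 0) :
    gramWeight k b c (Fin.cons x v : Fin (j + 1) → EuclideanSpace ℝ (Fin n)) ≤
      gramWeight k b c v * ((∑ i ∈ S, B.repr x i ^ 2) ^ (-k / 2) *
        (‖x‖ ^ (-b) * Real.exp (-c * ‖x‖ ^ 2))) := by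
  obtain ⟨u, hu, y, hy, rfl⟩ :=
    (Submodule.span ℝ (Set.range v)).exists_add_mem_mem_orthogonal x
  have hle : ∑ i ∈ S, B.repr (u + y) i ^ 2 ≤ ‖y‖ ^ 2 := by
    rw [← B.repr.norm_map y, EuclideanSpace.real_norm_sq_eq]
    refine (Finset.sum_le_sum_of_subset_of_nonneg (Finset.subset_univ S)
      fun i _ _ => sq_nonneg (B.repr y i)).trans' (Finset.sum_le_sum fun i hi => ?_)
    have h0 : B.repr u i = 0 := by
      rw [B.repr_apply_apply]
      exact (Submodule.mem_orthogonal' _ _).1 (hB i hi) u hu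
    simp [h0]
  have hpos : 0 < ∑ i ∈ S, B.repr (u + y) i ^ 2 :=
    lt_of_le_of_ne (Finset.sum_nonneg fun _ _ => sq_nonneg _) (Ne.symm hx)
  simp only [gramWeight, det_gram_cons_add v hu hy, Fin.prod_univ_succ, Fin.cons_zero,
    Fin.cons_succ]
  rw [Real.mul_rpow (det_gram_nonneg v) (sq_nonneg _)]
  have h := Real.rpow_le_rpow_of_nonpos hpos hle (z := -k / 2) (by linarith)
  have hg := Real.rpow_nonneg (det_gram_nonneg v) (-k / 2)
  have hR : 0 ≤ ∏ i, (‖v i‖ ^ (-b) * Real.exp (-c * ‖v i‖ ^ 2)) :=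
    Finset.prod_nonneg fun _ _ => by positivity
  have hW : 0 ≤ ‖u + y‖ ^ (-b) * Real.exp (-c * ‖u + y‖ ^ 2) := by positivity
  have := mul_le_mul_of_nonneg_left h (mul_nonneg (mul_nonneg hg hR) hW)
  linarith

/-- Induction on the number of vectors: the inner integral over the new vector has, after a
rotation, a bound that does not depend on the others. Dependent families carry no weight,
since `0` to a negative power is `0`. -/
theorem lintegral_gramWeight_lt_top {n p : ℕ} {k b c : ℝ} (hk : 0 < k) (hkp : k + p < n + 1)
    (hp : p < n) (hb : 0 ≤ b) (hkb : k + b < n) (hc : 0 < c) :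
    ∀ j ≤ p, ∫⁻ v : Fin j → EuclideanSpace ℝ (Fin n), ENNReal.ofReal (gramWeight k b c v) < ⊤ := by
  intro j
  induction j with
  | zero =>
    intro _
    rw [lintegral_unique]
    simp [gramWeight, volume_pi]
  | succ j ih =>
    intro hj
    have hIH := ih (by omega)
    set S : Finset (Fin n) := Finset.univ.filter fun i : Fin n => (i : ℕ) < n - j with hS
    have hcard : S.card = n - j := by
      rw [hS, Fin.card_filter_val_lt]; omega
    have hkS : k < S.card := by
      rw [hcard, Nat.cast_sub (by omega)]
      have : (j : ℝ) + 1 ≤ p := by exact_mod_cast hj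
      linarith
    set f : EuclideanSpace ℝ (Fin n) → ℝ := fun x =>
      (∑ i ∈ S, x i ^ 2) ^ (-k / 2) * (‖x‖ ^ (-b) * Real.exp (-c * ‖x‖ ^ 2)) with hf
    have hfint : Integrable f := integrable_partial_norm_rpow_mul S hk.le hkS hb hkb hc
    have hfmeas : Measurable f := by simp only [hf]; fun_prop
    have hSne : S.Nonempty := Finset.card_pos.1 (by omega)
    obtain ⟨i₀, hi₀⟩ := hSne
    have hne : ∀ᵐ x : EuclideanSpace ℝ (Fin n), ∑ i ∈ S, x i ^ 2 ≠ 0 := by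
      have h : ∀ᵐ y : Fin n → ℝ, y i₀ ≠ 0 := Measure.ae_eval_ne _ i₀ 0
      filter_upwards [(EuclideanSpace.volume_preserving_symm_measurableEquiv_toLp
        (Fin n)).quasiMeasurePreserving.ae h] with x hx
      have hx' : x i₀ ≠ 0 := hx
      exact (Finset.sum_pos' (fun i _ => sq_nonneg _) ⟨i₀, hi₀, by positivity⟩).ne'
    have hmp := (volume_preserving_piFinSuccAbove
      (fun _ : Fin (j + 1) => EuclideanSpace ℝ (Fin n)) 0).symm
    rw [← hmp.lintegral_comp_emb (MeasurableEquiv.measurableEmbedding _)]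
    have hm := measurable_gramWeight (n := n) k b c (j + 1)
    rw [Measure.volume_eq_prod, lintegral_prod_symm _ (by
      refine Measurable.aemeasurable ?_
      exact ENNReal.measurable_ofReal.comp (hm.comp (MeasurableEquiv.measurable _)))]
    calc _ ≤ ∫⁻ v : Fin j → EuclideanSpace ℝ (Fin n),
          ENNReal.ofReal (gramWeight k b c v) * ∫⁻ x, ENNReal.ofReal (f x) := by
          refine lintegral_mono fun v => ?_
          by_cases hv : LinearIndependent ℝ v
          · obtain ⟨B, hB⟩ := exists_orthonormalBasis_orthogonal hv
            have hBmp := B.repr.measurePreserving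
            rw [← hBmp.lintegral_comp (f := fun x => ENNReal.ofReal (f x)) (by fun_prop),
              ← lintegral_const_mul _ (by fun_prop)]
            refine lintegral_mono_ae ?_
            filter_upwards [hBmp.quasiMeasurePreserving.ae hne] with x hx
            rw [← ENNReal.ofReal_mul (by
              have := det_gram_nonneg v
              unfold gramWeight; positivity)]
            refine ENNReal.ofReal_le_ofReal ?_
            have := gramWeight_cons_le hk b c (S := S)
              (fun i hi => hB i (Finset.mem_filter.1 hi).2) x hx
            simp only [hf, LinearIsometryEquiv.norm_map]
            simpa [MeasurableEquiv.piFinSuccAbove, Fin.insertNthEquiv] using this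
          · have : ∀ x : EuclideanSpace ℝ (Fin n), gramWeight k b c
                ((MeasurableEquiv.piFinSuccAbove
                  (fun _ : Fin (j + 1) => EuclideanSpace ℝ (Fin n)) 0).symm (x, v)) = 0 := by
              intro x
              have h0 : (Matrix.gram ℝ ((MeasurableEquiv.piFinSuccAbove
                  (fun _ : Fin (j + 1) => EuclideanSpace ℝ (Fin n)) 0).symm (x, v))).det = 0 := by
                by_contra h
                refine hv ?_
                have := (Matrix.linearIndependent_of_det_gram_ne_zero h).comp Fin.succ
                  (Fin.succ_injective _)
                simpa [MeasurableEquiv.piFinSuccAbove, Fin.insertNthEquiv, Function.comp_def]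
                  using this
              rw [gramWeight, h0, Real.zero_rpow (by linarith), zero_mul]
            rw [lintegral_congr fun x => by rw [this x]]
            simp
      _ = (∫⁻ v : Fin j → EuclideanSpace ℝ (Fin n), ENNReal.ofReal (gramWeight k b c v)) *
            ∫⁻ x, ENNReal.ofReal (f x) := by
          rw [lintegral_mul_const]
          exact ENNReal.measurable_ofReal.comp (measurable_gramWeight k b c j)
      _ < ⊤ := ENNReal.mul_lt_top hIH hfint.lintegral_lt_top

end

/-! ### The singular value shrinkage priors -/

section

variable {n p : ℕ}

/-- The columns of a matrix, as a continuous linear equivalence. -/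
def colEquiv (n p : ℕ) : MatSpace n p ≃L[ℝ] (Fin p → EuclideanSpace ℝ (Fin n)) :=
  LinearEquiv.toContinuousLinearEquiv
    { toFun := fun M i => WithLp.toLp 2 fun a => M (a, i)
      map_add' := fun _ _ => rfl
      map_smul' := fun _ _ => rfl
      invFun := fun v => WithLp.toLp 2 fun q => v q.2 q.1
      left_inv := fun _ => rfl
      right_inv := fun _ => rfl }

@[simp]
theorem colEquiv_apply (M : MatSpace n p) (i : Fin p) (a : Fin n) :
    colEquiv n p M i a = M (a, i) := rfl

theorem gram_eq_gram_col (M : MatSpace n p) : gram M = Matrix.gram ℝ (colEquiv n p M) := by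
  ext i j
  simp [gram, toMat, Matrix.mul_apply, Matrix.gram_apply, PiLp.inner_apply, mul_comm]

theorem norm_sq_eq_sum_col (M : MatSpace n p) : ‖M‖ ^ 2 = ∑ i, ‖colEquiv n p M i‖ ^ 2 := by
  simp_rw [EuclideanSpace.real_norm_sq_eq, Fintype.sum_prod_type_right]
  rfl

theorem norm_sq_eq_trace_gram (M : MatSpace n p) : ‖M‖ ^ 2 = (gram M).trace := by
  rw [norm_sq_eq_sum_col, gram_eq_gram_col, Matrix.trace]
  simp [Matrix.gram_apply]

theorem det_gram_mat_nonneg (M : MatSpace n p) : 0 ≤ (gram M).det :=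
  gram_eq_gram_col M ▸ det_gram_nonneg _

theorem continuous_gram : Continuous (gram : MatSpace n p → Matrix (Fin p) (Fin p) ℝ) := by
  have : Continuous (toMat : MatSpace n p → Matrix (Fin n) (Fin p) ℝ) :=
    continuous_matrix fun a i => by simp only [toMat, Matrix.of_apply]; fun_prop
  exact this.matrix_transpose.matrix_mul this

theorem measurable_priorMSVS1 (γ : ℝ) : Measurable (priorMSVS1 γ : MatSpace n p → ℝ) := by
  have : Measurable fun M : MatSpace n p => (gram M).det :=
    continuous_gram.matrix_det.measurable
  unfold priorMSVS1 priorSVS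
  fun_prop

theorem priorMSVS1_nonneg (γ : ℝ) (M : MatSpace n p) : 0 ≤ priorMSVS1 γ M :=
  mul_nonneg (Real.rpow_nonneg (det_gram_mat_nonneg M) _) (Real.rpow_nonneg (norm_nonneg _) _)

theorem priorMSVS1_zero : (priorMSVS1 0 : MatSpace n p → ℝ) = priorSVS := by
  funext M
  simp [priorMSVS1]

theorem ne_zero_of_det_gram_ne_zero (hp : 0 < p) {M : MatSpace n p} (hM : (gram M).det ≠ 0) :
    M ≠ 0 := by
  rintro rfl
  have : Nonempty (Fin p) := ⟨⟨0, hp⟩⟩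
  refine hM ?_
  have h0 : gram (0 : MatSpace n p) = 0 := by
    ext i j
    simp [gram, toMat, Matrix.mul_apply]
  rw [h0, Matrix.det_zero]

/-- The prior is dominated by a weight on the columns. The factor `‖M‖ ^ (-γ)` is
shared equally among the columns, each of which is at most as long as `M`. -/
theorem priorMSVS1_mul_exp_le (hnp : p + 1 < n) (hp : 0 < p) {γ : ℝ} (hγ : 0 ≤ γ) (c : ℝ)
    (M : MatSpace n p) :
    priorMSVS1 γ M * Real.exp (-c * ‖M‖ ^ 2) ≤
      gramWeight ((n : ℝ) - p - 1) (γ / p) c (colEquiv n p M) := by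
  have hk : (0 : ℝ) < n - p - 1 := by
    have : (p : ℝ) + 1 < n := by exact_mod_cast hnp
    linarith
  have hp' : (0 : ℝ) < p := by exact_mod_cast hp
  rw [gramWeight, ← gram_eq_gram_col, priorMSVS1, priorSVS]
  by_cases hdet : (gram M).det = 0
  · rw [hdet, Real.zero_rpow (by linarith)]
    simp
  have hcol : ∀ i, colEquiv n p M i ≠ 0 := fun i h0 => by
    rw [gram_eq_gram_col] at hdet
    exact (Matrix.linearIndependent_of_det_gram_ne_zero hdet).ne_zero i h0
  have hnorm : ∀ i, ‖colEquiv n p M i‖ ≤ ‖M‖ := fun i => by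
    refine le_of_sq_le_sq ?_ (norm_nonneg _)
    rw [norm_sq_eq_sum_col]
    exact Finset.single_le_sum (f := fun i => ‖colEquiv n p M i‖ ^ 2)
      (fun j _ => sq_nonneg _) (Finset.mem_univ i)
  have h1 : ‖M‖ ^ (-γ) ≤ ∏ i, ‖colEquiv n p M i‖ ^ (-(γ / p)) := by
    have h2 : ‖M‖ ^ (-γ) = ∏ _i : Fin p, ‖M‖ ^ (-(γ / p)) := by
      rw [Finset.prod_const, Finset.card_univ, Fintype.card_fin, ← Real.rpow_natCast,
        ← Real.rpow_mul (norm_nonneg _)]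
      congr 1
      field_simp
    rw [h2]
    refine Finset.prod_le_prod (fun i _ => by positivity) fun i _ => ?_
    exact Real.rpow_le_rpow_of_nonpos (norm_pos_iff.2 (hcol i)) (hnorm i)
      (by have := div_nonneg hγ hp'.le; linarith)
  have hE : Real.exp (-c * ‖M‖ ^ 2) = ∏ i, Real.exp (-c * ‖colEquiv n p M i‖ ^ 2) := by
    rw [← Real.exp_sum, norm_sq_eq_sum_col, Finset.mul_sum]
  rw [Finset.prod_mul_distrib, ← hE, mul_assoc]
  have hg := Real.rpow_nonneg (det_gram_mat_nonneg M) (-((n : ℝ) - p - 1) / 2)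
  gcongr

theorem pos_of_sq_add_self_pos {γ : ℝ} (hγ₀ : 0 ≤ γ) (hγ : γ < (p : ℝ) ^ 2 + p) : 0 < p := by
  rcases Nat.eq_zero_or_pos p with rfl | h
  · simp at hγ; linarith
  · exact h

theorem integrable_priorMSVS1_mul_exp (hnp : p + 1 < n) {γ : ℝ} (hγ₀ : 0 ≤ γ)
    (hγ : γ < (p : ℝ) ^ 2 + p) {c : ℝ} (hc : 0 < c) :
    Integrable fun M : MatSpace n p => priorMSVS1 γ M * Real.exp (-c * ‖M‖ ^ 2) := by
  have hp := pos_of_sq_add_self_pos hγ₀ hγ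
  have hp' : (0 : ℝ) < p := by exact_mod_cast hp
  have hn : (p : ℝ) + 1 < n := by exact_mod_cast hnp
  have hb : γ / p < p + 1 := by rw [div_lt_iff₀ hp']; nlinarith
  have hlt := lintegral_gramWeight_lt_top (n := n) (p := p) (k := (n : ℝ) - p - 1) (b := γ / p)
    (c := c) (by linarith) (by linarith) (by omega) (by positivity) (by linarith) hc p le_rfl
  have hmeas := measurable_gramWeight (n := n) ((n : ℝ) - p - 1) (γ / p) c p
  have hnn : ∀ v, 0 ≤ gramWeight ((n : ℝ) - p - 1) (γ / p) c (n := n) (j := p) v := fun v => by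
    have := det_gram_nonneg v
    unfold gramWeight; positivity
  have hint : Integrable (gramWeight ((n : ℝ) - p - 1) (γ / p) c (n := n) (j := p)) := by
    refine ⟨hmeas.aestronglyMeasurable, ?_⟩
    rw [hasFiniteIntegral_iff_ofReal (ae_of_all _ hnn)]
    exact hlt
  have hmap : Integrable (gramWeight ((n : ℝ) - p - 1) (γ / p) c (n := n) (j := p))
      (volume.map (colEquiv n p)) := by
    have := (colEquiv n p).isAddHaarMeasure_map volume
    rw [Measure.isAddLeftInvariant_eq_smul (volume.map (colEquiv n p)) volume]
    exact hint.smul_measure (by simp)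
  have hcomp := (integrable_map_measure hmap.aestronglyMeasurable
    (colEquiv n p).continuous.measurable.aemeasurable).1 hmap
  refine hcomp.mono' ?_ (ae_of_all _ fun M => ?_)
  · have := measurable_priorMSVS1 (n := n) (p := p) γ
    exact Measurable.aestronglyMeasurable (by fun_prop)
  · rw [Real.norm_of_nonneg (mul_nonneg (priorMSVS1_nonneg γ M) (Real.exp_nonneg _))]
    exact priorMSVS1_mul_exp_le hnp hp hγ₀ c M

theorem det_gram_ne_zero_of_mem_fullRank {M : MatSpace n p} (hM : M ∈ fullRank n p) :
    (gram M).det ≠ 0 := by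
  have h1 : LinearIndependent ℝ (toMat M).col := by
    rw [linearIndependent_iff_card_eq_finrank_span, Set.finrank,
      ← Matrix.rank_eq_finrank_span_cols, Fintype.card_fin]
    exact Eq.symm hM
  rw [gram_eq_gram_col]
  refine Matrix.det_gram_ne_zero_iff_linearIndependent.2 ?_
  exact h1.map' (WithLp.linearEquiv 2 ℝ (Fin n → ℝ)).symm.toLinearMap (LinearEquiv.ker _)

theorem exists_det_gram_ne_zero (hnp : p + 1 < n) : ∃ M : MatSpace n p, (gram M).det ≠ 0 := by
  refine ⟨WithLp.toLp 2 fun q => if (q.1 : ℕ) = q.2 then 1 else 0, ?_⟩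
  have : gram (WithLp.toLp 2 fun q => if (q.1 : ℕ) = q.2 then 1 else 0 : MatSpace n p) = 1 := by
    ext i j
    simp only [gram, toMat, Matrix.mul_apply, Matrix.transpose_apply, Matrix.of_apply]
    rw [Finset.sum_eq_single (⟨i, by omega⟩ : Fin n)]
    · simp [Matrix.one_apply, Fin.ext_iff]
    · intro b _ hb
      rw [if_neg (fun h => hb (Fin.ext h)), zero_mul]
    · simp
  simp [this]

theorem contDiff_det_gram : ContDiff ℝ 3 fun M : MatSpace n p => (gram M).det := by
  simp only [Matrix.det_apply, gram, toMat, Matrix.mul_apply, Matrix.transpose_apply,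
    Matrix.of_apply]
  refine ContDiff.sum fun σ _ => ContDiff.const_smul _ ?_
  refine contDiff_prod fun i _ => ContDiff.sum fun a _ => ?_
  fun_prop

theorem contDiffAt_priorMSVS1 (hp : 0 < p) (γ : ℝ) {M : MatSpace n p} (hM : (gram M).det ≠ 0) :
    ContDiffAt ℝ 3 (priorMSVS1 γ) M :=
  (contDiff_det_gram.contDiffAt.rpow_const_of_ne hM).mul
    ((contDiffAt_norm ℝ (ne_zero_of_det_gram_ne_zero hp hM)).rpow_const_of_ne
      (norm_ne_zero_iff.2 (ne_zero_of_det_gram_ne_zero hp hM)))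

theorem priorMSVS1_pos (hp : 0 < p) (γ : ℝ) {M : MatSpace n p} (hM : (gram M).det ≠ 0) :
    0 < priorMSVS1 γ M :=
  mul_pos (Real.rpow_pos_of_pos ((det_gram_mat_nonneg M).lt_of_ne' hM) _)
    (Real.rpow_pos_of_pos (norm_pos_iff.2 (ne_zero_of_det_gram_ne_zero hp hM)) _)

/-- The gradient of `log π_SVS`. -/
def gradLogSVS (M : MatSpace n p) : MatSpace n p :=
  (priorSVS M)⁻¹ • gradient priorSVS M

/-- The gradient of `log π_MSVS1`, on the matrices of full column rank. -/
def gradLogMSVS1 (γ : ℝ) (M : MatSpace n p) : MatSpace n p :=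
  gradLogSVS M - (γ / ‖M‖ ^ 2) • M

theorem hasGradientAt_priorSVS (hp : 0 < p) {M : MatSpace n p} (hM : (gram M).det ≠ 0) :
    HasGradientAt priorSVS (priorSVS M • gradLogSVS M) M := by
  have hpos := priorMSVS1_pos hp 0 hM
  have hd := contDiffAt_priorMSVS1 hp 0 hM
  rw [priorMSVS1_zero] at hpos hd
  rw [gradLogSVS, smul_inv_smul₀ hpos.ne']
  exact (hd.differentiableAt (by norm_num)).hasGradientAt

theorem hasGradientAt_norm_rpow {E : Type*} [NormedAddCommGroup E] [InnerProductSpace ℝ E]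
    [CompleteSpace E] {x : E} (hx : x ≠ 0) (s : ℝ) :
    HasGradientAt (fun y : E => ‖y‖ ^ s) ((‖x‖ ^ s * (s / ‖x‖ ^ 2)) • x) x := by
  have hx' := norm_pos_iff.2 hx
  have h1 : HasFDerivAt (fun y : E => (‖y‖ ^ 2) ^ (s / 2)) _ x :=
    (hasStrictFDerivAt_norm_sq x).hasFDerivAt.rpow_const (p := s / 2) (Or.inl (by positivity))
  have h2 : (fun y : E => (‖y‖ ^ 2) ^ (s / 2)) = fun y : E => ‖y‖ ^ s := by
    funext y
    rw [← Real.rpow_natCast, ← Real.rpow_mul (norm_nonneg _)]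
    congr 1
    push_cast
    ring
  rw [h2] at h1
  rw [hasGradientAt_iff_hasFDerivAt]
  convert! h1 using 1
  ext v
  simp only [InnerProductSpace.toDual_apply_apply, inner_smul_left, _root_.smul_apply,
    innerSL_apply_apply, smul_eq_mul, conj_trivial]
  rw [Real.rpow_sub (by positivity), Real.rpow_one, ← Real.rpow_natCast, ← Real.rpow_mul
    (norm_nonneg _), show ((2 : ℕ) : ℝ) * (s / 2) = s by push_cast; ring]
  simp only [nsmul_eq_mul]
  push_cast
  ring

theorem hasGradientAt_priorMSVS1 (hp : 0 < p) (γ : ℝ) {M : MatSpace n p}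
    (hM : (gram M).det ≠ 0) :
    HasGradientAt (priorMSVS1 γ) (priorMSVS1 γ M • gradLogMSVS1 γ M) M := by
  have h1 := (hasGradientAt_priorSVS hp hM).hasFDerivAt.mul
    (hasGradientAt_norm_rpow (ne_zero_of_det_gram_ne_zero hp hM) (-γ)).hasFDerivAt
  rw [hasGradientAt_iff_hasFDerivAt]
  convert! h1 using 1
  ext v
  simp only [priorMSVS1, gradLogMSVS1, InnerProductSpace.toDual_apply_apply, inner_smul_left,
    _root_.smul_apply, smul_eq_mul, conj_trivial, inner_sub_left,
    _root_.add_apply]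
  ring

theorem priorSVS_smul {t : ℝ} (ht : 0 < t) (M : MatSpace n p) :
    priorSVS (t • M) = t ^ (-((p : ℝ) * (n - p - 1))) * priorSVS M := by
  have h1 : gram (t • M) = (t ^ 2) • gram M := by
    ext i j
    simp only [gram, toMat, Matrix.mul_apply, Matrix.transpose_apply, Matrix.of_apply,
      Matrix.smul_apply, PiLp.smul_apply, smul_eq_mul, Finset.mul_sum]
    exact Finset.sum_congr rfl fun _ _ => by ring
  rw [priorSVS, h1, Matrix.det_smul, Fintype.card_fin, Real.mul_rpow (by positivity)
    (det_gram_mat_nonneg M), priorSVS, ← pow_mul, ← Real.rpow_natCast, ← Real.rpow_mul ht.le]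
  congr 2
  push_cast
  ring

/-- Euler's identity for the homogeneous function `π_SVS`. -/
theorem inner_gradLogSVS (hp : 0 < p) {M : MatSpace n p} (hM : (gram M).det ≠ 0) :
    inner ℝ (gradLogSVS M) M = -((p : ℝ) * (n - p - 1)) := by
  have hpos := priorMSVS1_pos hp 0 hM
  rw [priorMSVS1_zero] at hpos
  have h0 : HasDerivAt (fun t : ℝ => t • M) M 1 := by
    simpa using (hasDerivAt_id (1 : ℝ)).smul_const M
  have hG := (hasGradientAt_priorSVS hp hM).hasFDerivAt
  have h1 := HasFDerivAt.comp_hasDerivAt (1 : ℝ) (f := fun t : ℝ => t • M)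
    (by simpa using hG) h0
  have h2 : HasDerivAt (fun t : ℝ => t ^ (-((p : ℝ) * (n - p - 1))) * priorSVS M)
      (-((p : ℝ) * (n - p - 1)) * priorSVS M) 1 := by
    simpa using (Real.hasDerivAt_rpow_const (x := 1) (p := -((p : ℝ) * (n - p - 1)))
      (Or.inl one_ne_zero)).mul_const (priorSVS M)
  have h3 := h1.unique (h2.congr_of_eventuallyEq (by
    filter_upwards [lt_mem_nhds (one_pos : (0 : ℝ) < 1)] with t ht
    exact priorSVS_smul ht M))
  change priorSVS M * inner ℝ (gradLogSVS M) M = _ at h3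
  rw [mul_comm] at h3
  exact mul_right_cancel₀ hpos.ne' h3

theorem differentiableAt_gradLogSVS (hp : 0 < p) {M : MatSpace n p} (hM : (gram M).det ≠ 0) :
    DifferentiableAt ℝ gradLogSVS M := by
  have hpos := priorMSVS1_pos hp 0 hM
  have hd := contDiffAt_priorMSVS1 hp 0 hM
  rw [priorMSVS1_zero] at hpos hd
  refine ((hd.differentiableAt (by norm_num)).inv hpos.ne').smul ?_
  have h1 : DifferentiableAt ℝ (fderiv ℝ (priorSVS : MatSpace n p → ℝ)) M :=
    (hd.fderiv_right (m := 1) (by norm_num)).differentiableAt (by norm_num)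
  exact (InnerProductSpace.toDual ℝ (MatSpace n p)).symm.toContinuousLinearEquiv
    |>.differentiableAt.comp M h1

theorem eventually_det_gram_ne_zero {M : MatSpace n p} (hM : (gram M).det ≠ 0) :
    ∀ᶠ Y in 𝓝 M, (gram Y).det ≠ 0 :=
  continuous_gram.matrix_det.continuousAt.eventually_ne hM

theorem hasFDerivAt_div_norm_sq_smul {E : Type*} [NormedAddCommGroup E] [InnerProductSpace ℝ E]
    {x : E} (hx : x ≠ 0) (γ : ℝ) :
    ∃ A : E →L[ℝ] E, HasFDerivAt (fun y : E => (γ / ‖y‖ ^ 2) • y) A x ∧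
      ∀ v, A v = (γ / ‖x‖ ^ 2) • v - (2 * γ * inner ℝ x v / ‖x‖ ^ 4) • x := by
  have hx' := norm_pos_iff.2 hx
  have h1 : HasFDerivAt (fun y : E => γ * (‖y‖ ^ 2)⁻¹) _ x :=
    ((hasDerivAt_inv (x := ‖x‖ ^ 2) (by positivity)).comp_hasFDerivAt x
      (hasStrictFDerivAt_norm_sq x).hasFDerivAt).const_mul γ
  refine ⟨_, h1.smul (hasFDerivAt_id x), fun v => ?_⟩
  simp only [div_eq_mul_inv, _root_.add_apply, _root_.smul_apply,
    ContinuousLinearMap.smulRight_apply, ContinuousLinearMap.id_apply, innerSL_apply_apply,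
    nsmul_eq_mul, smul_eq_mul, Nat.cast_ofNat]
  rw [sub_eq_add_neg, ← neg_smul]
  congr 2
  ring

theorem sum_div_norm_sq_apply {ι : Type*} [Fintype ι] [DecidableEq ι] {x : EuclideanSpace ℝ ι}
    (hx : x ≠ 0) (γ : ℝ) {A : EuclideanSpace ℝ ι → EuclideanSpace ℝ ι}
    (hA : ∀ v, A v = (γ / ‖x‖ ^ 2) • v - (2 * γ * inner ℝ x v / ‖x‖ ^ 4) • x) :
    ∑ i, A (EuclideanSpace.single i 1) i = γ * (Fintype.card ι - 2) / ‖x‖ ^ 2 := by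
  have hx' := norm_pos_iff.2 hx
  simp only [hA, PiLp.sub_apply, PiLp.smul_apply, smul_eq_mul, Finset.sum_sub_distrib,
    EuclideanSpace.inner_single_right]
  have h : ∑ i, 2 * γ * (1 * x i) / ‖x‖ ^ 4 * x i = 2 * γ / ‖x‖ ^ 4 * ‖x‖ ^ 2 := by
    rw [EuclideanSpace.real_norm_sq_eq, Finset.mul_sum]
    exact Finset.sum_congr rfl fun i _ => by ring
  simp only [conj_trivial, h]
  simp only [Finset.sum_const, Finset.card_univ, nsmul_eq_mul, PiLp.single_apply, if_true, mul_one]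
  field_simp

end

/-! ### The standard normal density and scaling -/

section

variable {n p : ℕ} {F : Type*} [NormedAddCommGroup F] [NormedSpace ℝ F]

/-- The density of a matrix of independent standard normal entries. -/
def stdDensity (x : MatSpace n p) : ℝ :=
  (√(2 * Real.pi))⁻¹ ^ (n * p) * Real.exp (-(1 / 2) * ‖x‖ ^ 2)

theorem stdDensity_pos (x : MatSpace n p) : 0 < stdDensity x := by
  unfold stdDensity; positivity

@[fun_prop]
theorem continuous_stdDensity : Continuous (stdDensity : MatSpace n p → ℝ) := by
  unfold stdDensity; fun_prop

@[simp]
theorem stdDensity_neg (x : MatSpace n p) : stdDensity (-x) = stdDensity x := by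
  simp [stdDensity]

theorem normalDensity_pos {N : ℕ} (hN : 1 ≤ N) (Y M : MatSpace n p) :
    0 < normalDensity N Y M := by
  have : (0 : ℝ) < N := by exact_mod_cast hN
  unfold normalDensity; positivity

theorem measurable_normalDensity (N : ℕ) :
    Measurable fun q : MatSpace n p × MatSpace n p => normalDensity N q.1 q.2 := by
  unfold normalDensity; fun_prop

theorem normalDensity_comm (N : ℕ) (Y M : MatSpace n p) :
    normalDensity N Y M = normalDensity N M Y := by
  simp only [normalDensity, norm_sub_rev]

theorem sqrt_natCast_pos {N : ℕ} (hN : 1 ≤ N) : 0 < √(N : ℝ) :=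
  Real.sqrt_pos.2 (by exact_mod_cast hN)

/-- Standardization of the normal density. -/
theorem normalDensity_add_smul {N : ℕ} (hN : 1 ≤ N) (Y x : MatSpace n p) :
    normalDensity N Y (Y + (√(N : ℝ))⁻¹ • x) = √(N : ℝ) ^ (n * p) * stdDensity x := by
  have hs := sqrt_natCast_pos hN
  have hss : √(N : ℝ) ^ 2 = N := Real.sq_sqrt (Nat.cast_nonneg N)
  have hnorm : ‖Y - (Y + (√(N : ℝ))⁻¹ • x)‖ ^ 2 = (N : ℝ)⁻¹ * ‖x‖ ^ 2 := by
    rw [sub_add_cancel_left, norm_neg, norm_smul, mul_pow, Real.norm_of_nonneg (by positivity),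
      inv_pow, hss]
  have hN0 : (N : ℝ) ≠ 0 := by positivity
  rw [normalDensity, hnorm, stdDensity, Real.rpow_div_two_eq_sqrt _ (by positivity),
    Real.rpow_natCast, Real.sqrt_div (Nat.cast_nonneg N), div_eq_mul_inv, mul_pow, mul_assoc]
  congr 3
  field_simp

theorem integral_comp_add_smul (g : MatSpace n p → F) {N : ℕ} (hN : 1 ≤ N) (Y : MatSpace n p) :
    ∫ x, g (Y + (√(N : ℝ))⁻¹ • x) = √(N : ℝ) ^ (n * p) • ∫ M, g M := by
  have hs := sqrt_natCast_pos hN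
  rw [Measure.integral_comp_inv_smul volume (fun z => g (Y + z)), integral_add_left_eq_self]
  simp [abs_of_pos hs]

theorem integrable_comp_add_smul {F : Type*} [NormedAddCommGroup F] {g : MatSpace n p → F}
    {N : ℕ} (hN : 1 ≤ N) (Y : MatSpace n p) :
    Integrable (fun x => g (Y + (√(N : ℝ))⁻¹ • x)) ↔ Integrable g := by
  have hs := sqrt_natCast_pos hN
  rw [integrable_comp_smul_iff volume (fun z => g (Y + z)) (inv_ne_zero hs.ne')]
  exact ⟨fun h => by simpa using h.comp_add_left (-Y), fun h => h.comp_add_left Y⟩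

theorem integral_normalDensity_smul (f : MatSpace n p → F) {N : ℕ} (hN : 1 ≤ N)
    (Y : MatSpace n p) :
    ∫ M, normalDensity N Y M • f M = ∫ x, stdDensity x • f (Y + (√(N : ℝ))⁻¹ • x) := by
  have hs := pow_pos (sqrt_natCast_pos hN) (n * p)
  have h := integral_comp_add_smul (fun M => normalDensity N Y M • f M) hN Y
  simp only [normalDensity_add_smul hN, mul_smul] at h
  rw [integral_smul] at h
  exact ((smul_right_injective _ hs.ne') h).symm

theorem integrable_normalDensity_smul {f : MatSpace n p → F} {N : ℕ} (hN : 1 ≤ N)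
    (Y : MatSpace n p) :
    Integrable (fun M => normalDensity N Y M • f M) ↔
      Integrable fun x => stdDensity x • f (Y + (√(N : ℝ))⁻¹ • x) := by
  have hs := pow_pos (sqrt_natCast_pos hN) (n * p)
  rw [← integrable_comp_add_smul hN Y]
  simp only [normalDensity_add_smul hN, mul_smul]
  exact integrable_smul_iff hs.ne' _

theorem integral_normalLaw (f : MatSpace n p → F) {N : ℕ} (hN : 1 ≤ N) (M : MatSpace n p) :
    ∫ Y, f Y ∂(normalLaw N M) = ∫ x, stdDensity x • f (M + (√(N : ℝ))⁻¹ • x) := by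
  rw [← integral_normalDensity_smul f hN M, normalLaw,
    integral_withDensity_eq_integral_toReal_smul]
  · refine integral_congr_ae (ae_of_all _ fun Y => ?_)
    simp only [ENNReal.toReal_ofReal (normalDensity_pos hN _ _).le, normalDensity_comm N M Y]
  · exact ((measurable_normalDensity N).comp (measurable_id.prodMk measurable_const)).ennreal_ofReal
  · simp

theorem integrable_normalLaw {f : MatSpace n p → F} {N : ℕ} (hN : 1 ≤ N) (M : MatSpace n p) :
    Integrable f (normalLaw N M) ↔
      Integrable fun x => stdDensity x • f (M + (√(N : ℝ))⁻¹ • x) := by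
  rw [← integrable_normalDensity_smul hN M, normalLaw, integrable_withDensity_iff_integrable_smul']
  · simp only [ENNReal.toReal_ofReal (normalDensity_pos hN _ _).le, normalDensity_comm N M]
  · exact ((measurable_normalDensity N).comp (measurable_id.prodMk measurable_const)).ennreal_ofReal
  · simp

theorem one_add_pow_le_exp_sq (k : ℕ) {c : ℝ} (hc : 0 < c) {t : ℝ} (ht : 0 ≤ t) :
    (1 + t) ^ k ≤ Real.exp ((k : ℝ) ^ 2 / (4 * c)) * Real.exp (c * t ^ 2) := by
  have h1 : 1 + t ≤ Real.exp t := by linarith [Real.add_one_le_exp t]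
  calc (1 + t) ^ k ≤ Real.exp t ^ k := by gcongr
    _ = Real.exp (k * t) := (Real.exp_nat_mul t k).symm
    _ ≤ Real.exp ((k : ℝ) ^ 2 / (4 * c) + c * t ^ 2) := by
      refine Real.exp_le_exp.2 ?_
      have : (k : ℝ) ^ 2 / (4 * c) + c * t ^ 2 - k * t = (k - 2 * c * t) ^ 2 / (4 * c) := by
        field_simp; ring
      have h2 : 0 ≤ (k - 2 * c * t) ^ 2 / (4 * c) := by positivity
      linarith
    _ = _ := Real.exp_add _ _

theorem integrable_exp_neg_mul_norm_sq {c : ℝ} (hc : 0 < c) :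
    Integrable fun x : MatSpace n p => Real.exp (-c * ‖x‖ ^ 2) := by
  have := (GaussianFourier.integrable_cexp_neg_mul_sq_norm_add (b := (c : ℂ)) (by simpa) 0
    (0 : MatSpace n p)).re
  refine this.congr (ae_of_all _ fun x => ?_)
  have : (-(c : ℂ) * (‖x‖ : ℂ) ^ 2 + 0 * (inner ℝ (0 : MatSpace n p) x : ℂ)) =
      ((-c * ‖x‖ ^ 2 : ℝ) : ℂ) := by push_cast; ring
  simp only [this, ← Complex.ofReal_exp]
  exact Complex.ofReal_re _

theorem integrable_one_add_norm_pow_mul_exp (k : ℕ) {c : ℝ} (hc : 0 < c) :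
    Integrable fun x : MatSpace n p => (1 + ‖x‖) ^ k * Real.exp (-c * ‖x‖ ^ 2) := by
  refine ((integrable_exp_neg_mul_norm_sq (n := n) (p := p) (half_pos hc)).const_mul
    (Real.exp ((k : ℝ) ^ 2 / (4 * (c / 2))))).mono' (by fun_prop) (ae_of_all _ fun x => ?_)
  rw [Real.norm_of_nonneg (by positivity)]
  have h := one_add_pow_le_exp_sq k (half_pos hc) (norm_nonneg x)
  calc _ ≤ (Real.exp ((k : ℝ) ^ 2 / (4 * (c / 2))) * Real.exp (c / 2 * ‖x‖ ^ 2)) *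
        Real.exp (-c * ‖x‖ ^ 2) := by gcongr
    _ = _ := by
      rw [mul_assoc, ← Real.exp_add]
      congr 2
      ring

theorem integrable_stdDensity_mul_pow (k : ℕ) :
    Integrable fun x : MatSpace n p => stdDensity x * (1 + ‖x‖) ^ k := by
  refine ((integrable_one_add_norm_pow_mul_exp (n := n) (p := p) k
    (by norm_num : (0 : ℝ) < 1 / 2)).const_mul ((√(2 * Real.pi))⁻¹ ^ (n * p))).congr
    (ae_of_all _ fun x => ?_)
  simp only [stdDensity]
  ring

theorem integrable_stdDensity_smul_of_le {f : MatSpace n p → F}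
    (hf : AEStronglyMeasurable f volume) (C : ℝ) (k : ℕ) (h : ∀ x, ‖f x‖ ≤ C * (1 + ‖x‖) ^ k) :
    Integrable fun x => stdDensity x • f x := by
  refine ((integrable_stdDensity_mul_pow (n := n) (p := p) k).const_mul C).mono'
    (continuous_stdDensity.aestronglyMeasurable.smul hf) (ae_of_all _ fun x => ?_)
  rw [norm_smul, Real.norm_of_nonneg (stdDensity_pos x).le]
  calc _ ≤ stdDensity x * (C * (1 + ‖x‖) ^ k) :=
        mul_le_mul_of_nonneg_left (h x) (stdDensity_pos x).le
    _ = _ := by ring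

theorem stdDensity_eq_prod (x : MatSpace n p) :
    stdDensity x = ∏ q, ProbabilityTheory.gaussianPDFReal 0 1 (x q) := by
  simp only [ProbabilityTheory.gaussianPDFReal, Finset.prod_mul_distrib, Finset.prod_const,
    ← Real.exp_sum, stdDensity, EuclideanSpace.real_norm_sq_eq, Finset.mul_sum]
  simp only [Finset.card_univ, Fintype.card_prod, Fintype.card_fin, NNReal.coe_one, mul_one,
    sub_zero]
  congr 3
  funext q
  ring

theorem integral_stdDensity_mul_prod (f : Fin n × Fin p → ℝ → ℝ) :
    ∫ x : MatSpace n p, stdDensity x * ∏ q, f q (x q) =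
      ∏ q, ∫ t, f q t ∂(ProbabilityTheory.gaussianReal 0 1) := by
  have hmp := EuclideanSpace.volume_preserving_symm_measurableEquiv_toLp (Fin n × Fin p)
  simp only [ProbabilityTheory.integral_gaussianReal_eq_integral_smul one_ne_zero]
  rw [← integral_fintype_prod_volume_eq_prod,
    ← hmp.integral_comp (MeasurableEquiv.measurableEmbedding _)]
  refine integral_congr_ae (ae_of_all _ fun x => ?_)
  simp only [stdDensity_eq_prod, ← Finset.prod_mul_distrib]
  rfl

theorem integral_stdDensity : ∫ x : MatSpace n p, stdDensity x = 1 := by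
  have h := integral_stdDensity_mul_prod (n := n) (p := p) fun _ _ => 1
  simpa only [Finset.prod_const_one, mul_one, integral_const, probReal_univ, smul_eq_mul] using h

theorem integral_sq_gaussianReal :
    ∫ t, t ^ 2 ∂(ProbabilityTheory.gaussianReal 0 1) = 1 := by
  have h := ProbabilityTheory.variance_id_gaussianReal (μ := 0) (v := 1)
  rw [ProbabilityTheory.variance_of_integral_eq_zero measurable_id.aemeasurable
    (by simp)] at h
  simpa using h

theorem integral_stdDensity_mul_coord (i j : Fin n × Fin p) :
    ∫ x : MatSpace n p, stdDensity x * (x i * x j) = if i = j then 1 else 0 := by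
  have h := integral_stdDensity_mul_prod (n := n) (p := p)
    fun q t => (if q = i then t else 1) * (if q = j then t else 1)
  simp only [Finset.prod_mul_distrib, Finset.prod_ite_eq', Finset.mem_univ, if_true] at h
  rw [h]
  split_ifs with hij
  · subst hij
    refine Finset.prod_eq_one fun q _ => ?_
    by_cases hq : q = i
    · simpa [hq, ← sq] using integral_sq_gaussianReal
    · simp [hq]
  · refine Finset.prod_eq_zero (Finset.mem_univ i) ?_
    simp [hij]

theorem integral_eq_zero_of_odd {f : MatSpace n p → F} (hf : ∀ x, f (-x) = -f x) :
    ∫ x, f x = 0 := by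
  have h := integral_neg_eq_self f volume
  simp only [hf, integral_neg] at h
  have h2 : (2 : ℝ) • ∫ x, f x = 0 := by
    rw [two_smul]
    nth_rw 1 [← h]
    exact neg_add_cancel _
  exact (smul_eq_zero.1 h2).resolve_left two_ne_zero

theorem integrable_stdDensity_mul_coord (i j : Fin n × Fin p) :
    Integrable fun x : MatSpace n p => stdDensity x * (x i * x j) := by
  refine integrable_stdDensity_smul_of_le (f := fun x : MatSpace n p => x i * x j)
    (by fun_prop) 1 2 fun x => ?_
  have h1 := PiLp.norm_apply_le x i
  have h2 := PiLp.norm_apply_le x j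
  rw [norm_mul, one_mul, sq]
  gcongr <;> linarith

/-- The expectation of a quadratic form in a standard normal vector is its trace. -/
theorem integral_stdDensity_mul_inner (A : MatSpace n p →L[ℝ] MatSpace n p) :
    ∫ x : MatSpace n p, stdDensity x * inner ℝ x (A x) =
      ∑ i, A (EuclideanSpace.single i 1) i := by
  have hA : ∀ x : MatSpace n p, ∀ i, A x i = ∑ j, x j * A (EuclideanSpace.single j 1) i := by
    intro x i
    conv_lhs => rw [← (EuclideanSpace.basisFun (Fin n × Fin p) ℝ).sum_repr x]
    simp [map_sum]
  have h : ∀ x : MatSpace n p, stdDensity x * inner ℝ x (A x) =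
      ∑ i, ∑ j, A (EuclideanSpace.single j 1) i * (stdDensity x * (x i * x j)) := by
    intro x
    rw [PiLp.inner_apply, Finset.mul_sum]
    refine Finset.sum_congr rfl fun i _ => ?_
    rw [hA]
    simp only [RCLike.inner_apply, conj_trivial, Finset.sum_mul, Finset.mul_sum]
    exact Finset.sum_congr rfl fun j _ => by ring
  simp only [h]
  rw [integral_finsetSum _ fun i _ => integrable_finsetSum _ fun j _ =>
    (integrable_stdDensity_mul_coord i j).const_mul _]
  refine Finset.sum_congr rfl fun i _ => ?_
  rw [integral_finsetSum _ fun j _ => (integrable_stdDensity_mul_coord i j).const_mul _]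
  simp only [integral_const_mul, integral_stdDensity_mul_coord]
  simp

theorem integral_stdDensity_mul_norm_sq :
    ∫ x : MatSpace n p, stdDensity x * ‖x‖ ^ 2 = (n * p : ℕ) := by
  have h := integral_stdDensity_mul_inner (ContinuousLinearMap.id ℝ (MatSpace n p))
  simpa using h

theorem integral_stdDensity_inner_smul (v : MatSpace n p) :
    ∫ x : MatSpace n p, stdDensity x • ((inner ℝ v x : ℝ) • x) = v := by
  have hint : Integrable fun x : MatSpace n p => stdDensity x • ((inner ℝ v x : ℝ) • x) := by
    refine integrable_stdDensity_smul_of_le (by fun_prop) ‖v‖ 2 fun x => ?_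
    have h := norm_inner_le_norm (𝕜 := ℝ) v x
    have h0 := norm_nonneg x
    rw [norm_smul]
    calc _ ≤ (‖v‖ * ‖x‖) * ‖x‖ := by gcongr
      _ = ‖v‖ * ‖x‖ ^ 2 := by ring
      _ ≤ _ := by gcongr; linarith
  refine ext_inner_left ℝ fun w => ?_
  rw [← integral_inner hint]
  have h := integral_stdDensity_mul_inner
    ((innerSL ℝ v).smulRight w : MatSpace n p →L[ℝ] MatSpace n p)
  have h2 : ∀ x : MatSpace n p, inner ℝ w (stdDensity x • ((inner ℝ v x : ℝ) • x)) =
      stdDensity x * inner ℝ x (((innerSL ℝ v).smulRight w) x) := fun x => by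
    simp only [inner_smul_right, ContinuousLinearMap.smulRight_apply, innerSL_apply_apply,
      real_inner_comm w x]
  simp only [h2, h]
  simp [PiLp.inner_apply]

end

/-! ### Posterior moments, growth of the score, and finiteness of the risk -/

section

variable {n p : ℕ}

theorem normalDensity_eq (N : ℕ) (Y M : MatSpace n p) :
    normalDensity N Y M = √(N : ℝ) ^ (n * p) *
      ((√(2 * Real.pi))⁻¹ ^ (n * p) * Real.exp (-((N : ℝ) / 2) * ‖Y - M‖ ^ 2)) := by
  rw [normalDensity, Real.rpow_div_two_eq_sqrt _ (by positivity), Real.rpow_natCast,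
    Real.sqrt_div (Nat.cast_nonneg N), div_eq_mul_inv, mul_pow, mul_assoc]

/-- The properties of a prior density that give a posterior with all moments, of polynomial growth
in the observation. -/
structure GaussianIntegrablePrior (π : MatSpace n p → ℝ) : Prop where
  measurable : Measurable π
  nonneg : ∀ M, 0 ≤ π M
  integrable : Integrable fun M => π M * Real.exp (-(1 / 8) * ‖M‖ ^ 2)
  exists_ball_le : ∃ M₀ : MatSpace n p, ∃ ρ > 0, ∃ c > 0, ∀ M ∈ Metric.ball M₀ ρ, c ≤ π M

/-- The marginal density at `Y`, as an expectation over a standard normal perturbation. -/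
def postMass (N : ℕ) (π : MatSpace n p → ℝ) (Y : MatSpace n p) : ℝ :=
  ∫ x, stdDensity x * π (Y + (√(N : ℝ))⁻¹ • x)

/-- The score of the marginal density at `Y`: the posterior mean is `Y` plus `N⁻¹` times it
(Tweedie's formula). -/
def postScore (N : ℕ) (π : MatSpace n p → ℝ) (Y : MatSpace n p) : MatSpace n p :=
  (√(N : ℝ) * (postMass N π Y)⁻¹) • ∫ x, (stdDensity x * π (Y + (√(N : ℝ))⁻¹ • x)) • x

theorem marginal_eq_postMass {N : ℕ} (hN : 1 ≤ N) (π : MatSpace n p → ℝ) (Y : MatSpace n p) :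
    marginal N π Y = postMass N π Y :=
  integral_normalDensity_smul π hN Y

theorem inv_sqrt_natCast_le_one {N : ℕ} (hN : 1 ≤ N) : (√(N : ℝ))⁻¹ ≤ 1 :=
  inv_le_one_of_one_le₀ (Real.one_le_sqrt.2 (by exact_mod_cast hN))

theorem norm_inv_sqrt_smul_le {N : ℕ} (hN : 1 ≤ N) (x : MatSpace n p) :
    ‖(√(N : ℝ))⁻¹ • x‖ ≤ ‖x‖ := by
  rw [norm_smul, Real.norm_of_nonneg (by positivity)]
  exact mul_le_of_le_one_left (norm_nonneg _) (inv_sqrt_natCast_le_one hN)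

theorem exists_one_add_norm_pow_mul_stdDensity_le (n p k : ℕ) :
    ∃ C : ℝ, 0 ≤ C ∧ ∀ x : MatSpace n p,
      (1 + ‖x‖) ^ k * stdDensity x ≤ C * Real.exp (-(3 / 8) * ‖x‖ ^ 2) := by
  refine ⟨(√(2 * Real.pi))⁻¹ ^ (n * p) * Real.exp ((k : ℝ) ^ 2 / (4 * (1 / 8))), by positivity,
    fun x => ?_⟩
  have h := one_add_pow_le_exp_sq k (by norm_num : (0 : ℝ) < 1 / 8) (norm_nonneg x)
  have hE : Real.exp (-(3 / 8) * ‖x‖ ^ 2) =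
      Real.exp (1 / 8 * ‖x‖ ^ 2) * Real.exp (-(1 / 2) * ‖x‖ ^ 2) := by
    rw [← Real.exp_add]; congr 1; ring
  rw [hE, stdDensity]
  calc _ = (√(2 * Real.pi))⁻¹ ^ (n * p) * (1 + ‖x‖) ^ k * Real.exp (-(1 / 2) * ‖x‖ ^ 2) := by ring
    _ ≤ (√(2 * Real.pi))⁻¹ ^ (n * p) * (Real.exp ((k : ℝ) ^ 2 / (4 * (1 / 8))) *
        Real.exp (1 / 8 * ‖x‖ ^ 2)) * Real.exp (-(1 / 2) * ‖x‖ ^ 2) := by gcongr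
    _ = _ := by ring

namespace GaussianIntegrablePrior

variable {π : MatSpace n p → ℝ} (hπ : GaussianIntegrablePrior π)
include hπ

theorem exp_mul_shift_le (Y z : MatSpace n p) :
    Real.exp (-(1 / 4) * ‖z‖ ^ 2) * π (Y + z) ≤
      Real.exp (1 / 4 * ‖Y‖ ^ 2) * (π (Y + z) * Real.exp (-(1 / 8) * ‖Y + z‖ ^ 2)) := by
  have h1 : ‖Y + z‖ ^ 2 ≤ 2 * ‖Y‖ ^ 2 + 2 * ‖z‖ ^ 2 := by
    have := norm_add_le Y z
    nlinarith [norm_nonneg (Y + z), norm_nonneg Y, norm_nonneg z, sq_nonneg (‖Y‖ - ‖z‖)]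
  have h2 : Real.exp (-(1 / 4) * ‖z‖ ^ 2) ≤
      Real.exp (1 / 4 * ‖Y‖ ^ 2) * Real.exp (-(1 / 8) * ‖Y + z‖ ^ 2) := by
    rw [← Real.exp_add]
    exact Real.exp_le_exp.2 (by linarith)
  calc _ ≤ (Real.exp (1 / 4 * ‖Y‖ ^ 2) * Real.exp (-(1 / 8) * ‖Y + z‖ ^ 2)) * π (Y + z) :=
        mul_le_mul_of_nonneg_right h2 (hπ.nonneg _)
    _ = _ := by ring

theorem integrable_exp_mul_shift (Y : MatSpace n p) :
    Integrable fun z => Real.exp (-(1 / 4) * ‖z‖ ^ 2) * π (Y + z) := by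
  have hm := hπ.measurable
  refine ((hπ.integrable.comp_add_left Y).const_mul (Real.exp (1 / 4 * ‖Y‖ ^ 2))).mono'
    (Measurable.aestronglyMeasurable (by fun_prop)) (ae_of_all _ fun z => ?_)
  rw [Real.norm_of_nonneg (mul_nonneg (Real.exp_nonneg _) (hπ.nonneg _))]
  exact hπ.exp_mul_shift_le Y z

theorem integral_exp_mul_shift_le (Y : MatSpace n p) :
    ∫ z, Real.exp (-(1 / 4) * ‖z‖ ^ 2) * π (Y + z) ≤
      Real.exp (1 / 4 * ‖Y‖ ^ 2) * ∫ M, π M * Real.exp (-(1 / 8) * ‖M‖ ^ 2) := by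
  rw [← integral_const_mul,
    ← integral_add_left_eq_self
      (fun M => Real.exp (1 / 4 * ‖Y‖ ^ 2) * (π M * Real.exp (-(1 / 8) * ‖M‖ ^ 2))) Y]
  exact integral_mono (hπ.integrable_exp_mul_shift Y)
    ((hπ.integrable.comp_add_left Y).const_mul _) fun z => hπ.exp_mul_shift_le Y z

theorem integrable_exp_mul_scaled {N : ℕ} (hN : 1 ≤ N) (Y : MatSpace n p) :
    Integrable fun x => Real.exp (-(1 / 4) * ‖(√(N : ℝ))⁻¹ • x‖ ^ 2) *
      π (Y + (√(N : ℝ))⁻¹ • x) := by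
  have h := (integrable_comp_add_smul hN (0 : MatSpace n p)).2 (hπ.integrable_exp_mul_shift Y)
  simpa only [zero_add] using h

theorem integral_exp_mul_scaled_le {N : ℕ} (hN : 1 ≤ N) (Y : MatSpace n p) :
    ∫ x, Real.exp (-(1 / 4) * ‖(√(N : ℝ))⁻¹ • x‖ ^ 2) * π (Y + (√(N : ℝ))⁻¹ • x) ≤
      √(N : ℝ) ^ (n * p) * (Real.exp (1 / 4 * ‖Y‖ ^ 2) *
        ∫ M, π M * Real.exp (-(1 / 8) * ‖M‖ ^ 2)) := by
  have h := integral_comp_add_smul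
    (fun z => Real.exp (-(1 / 4) * ‖z‖ ^ 2) * π (Y + z)) hN (0 : MatSpace n p)
  simp only [zero_add] at h
  rw [h, smul_eq_mul]
  exact mul_le_mul_of_nonneg_left (hπ.integral_exp_mul_shift_le Y) (by positivity)

theorem exp_quarter_mul_scaled_le {N : ℕ} (hN : 1 ≤ N) (Y x : MatSpace n p) :
    Real.exp (-(1 / 4) * ‖x‖ ^ 2) * π (Y + (√(N : ℝ))⁻¹ • x) ≤
      Real.exp (-(1 / 4) * ‖(√(N : ℝ))⁻¹ • x‖ ^ 2) * π (Y + (√(N : ℝ))⁻¹ • x) := by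
  refine mul_le_mul_of_nonneg_right (Real.exp_le_exp.2 ?_) (hπ.nonneg _)
  have := pow_le_pow_left₀ (norm_nonneg _) (norm_inv_sqrt_smul_le hN x) 2
  linarith

theorem integrable_exp_quarter_mul_scaled {N : ℕ} (hN : 1 ≤ N) (Y : MatSpace n p) :
    Integrable fun x => Real.exp (-(1 / 4) * ‖x‖ ^ 2) * π (Y + (√(N : ℝ))⁻¹ • x) := by
  have hm := hπ.measurable
  refine (hπ.integrable_exp_mul_scaled hN Y).mono'
    (Measurable.aestronglyMeasurable (by fun_prop)) (ae_of_all _ fun x => ?_)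
  rw [Real.norm_of_nonneg (mul_nonneg (Real.exp_nonneg _) (hπ.nonneg _))]
  exact hπ.exp_quarter_mul_scaled_le hN Y x

/-- The posterior has all moments. -/
theorem integrable_pow_mul {N : ℕ} (hN : 1 ≤ N) (Y : MatSpace n p) (k : ℕ) :
    Integrable fun x => (1 + ‖x‖) ^ k * (stdDensity x * π (Y + (√(N : ℝ))⁻¹ • x)) := by
  have hm := hπ.measurable
  obtain ⟨C, hC, h⟩ := exists_one_add_norm_pow_mul_stdDensity_le n p k
  refine ((hπ.integrable_exp_quarter_mul_scaled hN Y).const_mul C).mono'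
    (Measurable.aestronglyMeasurable (by fun_prop)) (ae_of_all _ fun x => ?_)
  have h1 := stdDensity_pos x
  have h2 := hπ.nonneg (Y + (√(N : ℝ))⁻¹ • x)
  rw [Real.norm_of_nonneg (by positivity), ← mul_assoc, ← mul_assoc]
  refine mul_le_mul_of_nonneg_right ((h x).trans (mul_le_mul_of_nonneg_left ?_ hC)) h2
  exact Real.exp_le_exp.2 (by nlinarith [sq_nonneg ‖x‖])

theorem integrable_mass {N : ℕ} (hN : 1 ≤ N) (Y : MatSpace n p) :
    Integrable fun x => stdDensity x * π (Y + (√(N : ℝ))⁻¹ • x) := by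
  simpa using hπ.integrable_pow_mul hN Y 0

theorem integrable_mass_smul {N : ℕ} (hN : 1 ≤ N) (Y : MatSpace n p) :
    Integrable fun x => (stdDensity x * π (Y + (√(N : ℝ))⁻¹ • x)) • x := by
  have hm := hπ.measurable
  refine (hπ.integrable_pow_mul hN Y 1).mono'
    (Measurable.aestronglyMeasurable (by fun_prop)) (ae_of_all _ fun x => ?_)
  have h1 := stdDensity_pos x
  have h2 := hπ.nonneg (Y + (√(N : ℝ))⁻¹ • x)
  rw [norm_smul, Real.norm_of_nonneg (by positivity), mul_comm]
  gcongr
  linarith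

/-- A lower bound for the marginal density that uses the prior only on one ball. It decays like
`exp (-N * O(1 + ‖Y‖ ^ 2))`, which is harmless once its logarithm is taken and divided by `N`. -/
theorem exists_postMass_ge : ∃ κ > 0, ∃ R ≥ 0, ∀ N : ℕ, 1 ≤ N → ∀ Y : MatSpace n p,
    √(N : ℝ) ^ (n * p) * (κ * Real.exp (-((N : ℝ) / 2) * (‖Y‖ + R) ^ 2)) ≤ postMass N π Y := by
  obtain ⟨M₀, ρ, hρ, c, hc, hball⟩ := hπ.exists_ball_le
  have hvol : 0 < volume.real (Metric.ball M₀ ρ) :=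
    ENNReal.toReal_pos (Metric.measure_ball_pos _ _ hρ).ne' measure_ball_lt_top.ne
  refine ⟨(√(2 * Real.pi))⁻¹ ^ (n * p) * c * volume.real (Metric.ball M₀ ρ), by positivity,
    ‖M₀‖ + ρ, by positivity, fun N hN Y => ?_⟩
  rw [← marginal_eq_postMass hN]
  have hint : Integrable fun M => normalDensity N Y M * π M :=
    (integrable_normalDensity_smul (f := π) hN Y).2 (hπ.integrable_mass hN Y)
  have h1 : ∫ M in Metric.ball M₀ ρ, normalDensity N Y M * π M ≤ marginal N π Y :=
    setIntegral_le_integral hint (ae_of_all _ fun M =>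
      mul_nonneg (normalDensity_pos hN Y M).le (hπ.nonneg M))
  refine le_trans ?_ h1
  have h2 := setIntegral_mono_on (μ := volume) (s := Metric.ball M₀ ρ)
    (f := fun _ => √(N : ℝ) ^ (n * p) * ((√(2 * Real.pi))⁻¹ ^ (n * p) *
      Real.exp (-((N : ℝ) / 2) * (‖Y‖ + (‖M₀‖ + ρ)) ^ 2)) * c)
    (g := fun M => normalDensity N Y M * π M)
    (integrableOn_const measure_ball_lt_top.ne) hint.integrableOn measurableSet_ball (by
      intro M hM
      rw [normalDensity_eq]
      have hYM : ‖Y - M‖ ≤ ‖Y‖ + (‖M₀‖ + ρ) := by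
        have h3 : ‖M‖ ≤ ‖M₀‖ + ρ := by
          have := norm_le_norm_add_norm_sub' M M₀
          rw [← dist_eq_norm] at this
          linarith [Metric.mem_ball.1 hM]
        linarith [norm_sub_le Y M]
      have h4 : Real.exp (-((N : ℝ) / 2) * (‖Y‖ + (‖M₀‖ + ρ)) ^ 2) ≤
          Real.exp (-((N : ℝ) / 2) * ‖Y - M‖ ^ 2) := by
        refine Real.exp_le_exp.2 ?_
        have := pow_le_pow_left₀ (norm_nonneg _) hYM 2
        have hN0 : (0 : ℝ) ≤ N := Nat.cast_nonneg N
        nlinarith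
      have := hball M hM
      gcongr)
  rw [setIntegral_const, smul_eq_mul] at h2
  linarith

theorem postMass_pos {N : ℕ} (hN : 1 ≤ N) (Y : MatSpace n p) : 0 < postMass N π Y := by
  obtain ⟨κ, hκ, R, -, h⟩ := hπ.exists_postMass_ge
  have := sqrt_natCast_pos hN
  exact lt_of_lt_of_le (by positivity) (h N hN Y)

/-- By Jensen's inequality the posterior mean of `‖x‖ ^ 2 / 4` is at most the logarithm of the
posterior mean of `exp (‖x‖ ^ 2 / 4)`, which is a ratio of two marginals. -/
theorem exists_second_moment_le : ∃ C ≥ 0, ∀ N : ℕ, 1 ≤ N → ∀ Y : MatSpace n p,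
    ∫ x, ‖x‖ ^ 2 * (stdDensity x * π (Y + (√(N : ℝ))⁻¹ • x)) ≤
      C * N * (1 + ‖Y‖ ^ 2) * postMass N π Y := by
  obtain ⟨κ, hκ, R, hR, hlow⟩ := hπ.exists_postMass_ge
  set I := ∫ M, π M * Real.exp (-(1 / 8) * ‖M‖ ^ 2) with hI
  have hI0 : 0 ≤ I := integral_nonneg fun M => mul_nonneg (hπ.nonneg M) (Real.exp_nonneg _)
  set s := (√(2 * Real.pi))⁻¹ ^ (n * p) with hs
  have hs0 : 0 < s := by positivity
  set l := s * I / κ with hl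
  have hl0 : 0 ≤ l := by positivity
  refine ⟨4 * (2 + R ^ 2 + l), by positivity, fun N hN Y => ?_⟩
  have hN1 : (1 : ℝ) ≤ N := by exact_mod_cast hN
  set a := (2 + R ^ 2 + l) * N * (1 + ‖Y‖ ^ 2) with ha
  have hP := hπ.postMass_pos hN Y
  have hexp : ∀ x : MatSpace n p, Real.exp (1 / 4 * ‖x‖ ^ 2) *
      (stdDensity x * π (Y + (√(N : ℝ))⁻¹ • x)) =
      s * (Real.exp (-(1 / 4) * ‖x‖ ^ 2) * π (Y + (√(N : ℝ))⁻¹ • x)) := fun x => by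
    have : Real.exp (-(1 / 4) * ‖x‖ ^ 2) =
        Real.exp (1 / 4 * ‖x‖ ^ 2) * Real.exp (-(1 / 2) * ‖x‖ ^ 2) := by
      rw [← Real.exp_add]; congr 1; ring
    rw [stdDensity, this]; ring
  have hup : ∫ x, Real.exp (1 / 4 * ‖x‖ ^ 2) * (stdDensity x * π (Y + (√(N : ℝ))⁻¹ • x)) ≤
      Real.exp a * postMass N π Y := by
    simp only [hexp, integral_const_mul]
    have h1 := (integral_mono (hπ.integrable_exp_quarter_mul_scaled hN Y)
      (hπ.integrable_exp_mul_scaled hN Y)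
      fun x => hπ.exp_quarter_mul_scaled_le hN Y x).trans (hπ.integral_exp_mul_scaled_le hN Y)
    have h2 := hlow N hN Y
    have hlexp : l ≤ Real.exp l := by linarith [Real.add_one_le_exp l]
    have h3 : Real.exp (1 / 4 * ‖Y‖ ^ 2) * Real.exp l ≤
        Real.exp a * Real.exp (-((N : ℝ) / 2) * (‖Y‖ + R) ^ 2) := by
      rw [← Real.exp_add, ← Real.exp_add]
      refine Real.exp_le_exp.2 ?_
      have h4 : (‖Y‖ + R) ^ 2 ≤ 2 * ‖Y‖ ^ 2 + 2 * R ^ 2 := by nlinarith [sq_nonneg (‖Y‖ - R)]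
      have h5 : (N : ℝ) / 2 * (‖Y‖ + R) ^ 2 ≤ N * (‖Y‖ ^ 2 + R ^ 2) := by nlinarith
      have h6 : l ≤ l * N * (1 + ‖Y‖ ^ 2) := by
        have : 1 ≤ N * (1 + ‖Y‖ ^ 2) := by nlinarith [sq_nonneg ‖Y‖]
        nlinarith
      have h7 : (0 : ℝ) ≤ N * (R ^ 2 * ‖Y‖ ^ 2) := by positivity
      have h8 : ‖Y‖ ^ 2 ≤ N * ‖Y‖ ^ 2 := by nlinarith [sq_nonneg ‖Y‖]
      rw [ha]
      nlinarith
    calc _ ≤ s * (√(N : ℝ) ^ (n * p) * (Real.exp (1 / 4 * ‖Y‖ ^ 2) * I)) := by gcongr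
      _ = √(N : ℝ) ^ (n * p) * κ * (Real.exp (1 / 4 * ‖Y‖ ^ 2) * l) := by
        rw [hl]; field_simp
      _ ≤ √(N : ℝ) ^ (n * p) * κ * (Real.exp (1 / 4 * ‖Y‖ ^ 2) * Real.exp l) := by gcongr
      _ ≤ √(N : ℝ) ^ (n * p) * κ *
          (Real.exp a * Real.exp (-((N : ℝ) / 2) * (‖Y‖ + R) ^ 2)) := by gcongr
      _ = Real.exp a * (√(N : ℝ) ^ (n * p) *
          (κ * Real.exp (-((N : ℝ) / 2) * (‖Y‖ + R) ^ 2))) := by ring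
      _ ≤ _ := by gcongr
  -- Jensen's inequality, by the tangent line of `exp` at `a`
  have hint1 := hπ.integrable_mass hN Y
  have hint2 : Integrable fun x => ‖x‖ ^ 2 * (stdDensity x * π (Y + (√(N : ℝ))⁻¹ • x)) := by
    have hm := hπ.measurable
    refine (hπ.integrable_pow_mul hN Y 2).mono'
      (Measurable.aestronglyMeasurable (by fun_prop)) (ae_of_all _ fun x => ?_)
    have h1 := stdDensity_pos x
    have h2 := hπ.nonneg (Y + (√(N : ℝ))⁻¹ • x)
    rw [Real.norm_of_nonneg (by positivity)]
    gcongr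
    linarith
  have hint3 : Integrable fun x => Real.exp (1 / 4 * ‖x‖ ^ 2) *
      (stdDensity x * π (Y + (√(N : ℝ))⁻¹ • x)) := by
    simp only [hexp]
    exact (hπ.integrable_exp_quarter_mul_scaled hN Y).const_mul s
  have hmono := integral_mono
    (f := fun x => Real.exp a * (1 - a) * (stdDensity x * π (Y + (√(N : ℝ))⁻¹ • x)) +
      Real.exp a / 4 * (‖x‖ ^ 2 * (stdDensity x * π (Y + (√(N : ℝ))⁻¹ • x))))
    ((hint1.const_mul _).add (hint2.const_mul _)) hint3 (fun x => by
      have h1 := stdDensity_pos x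
      have h2 := hπ.nonneg (Y + (√(N : ℝ))⁻¹ • x)
      have h3 : Real.exp a * (1 + (1 / 4 * ‖x‖ ^ 2 - a)) ≤ Real.exp (1 / 4 * ‖x‖ ^ 2) := by
        have h4 := Real.add_one_le_exp (1 / 4 * ‖x‖ ^ 2 - a)
        calc _ ≤ Real.exp a * Real.exp (1 / 4 * ‖x‖ ^ 2 - a) := by gcongr; linarith
          _ = _ := by rw [← Real.exp_add]; congr 1; ring
      calc _ = Real.exp a * (1 + (1 / 4 * ‖x‖ ^ 2 - a)) *
            (stdDensity x * π (Y + (√(N : ℝ))⁻¹ • x)) := by ring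
        _ ≤ _ := by gcongr)
  rw [integral_add (hint1.const_mul _) (hint2.const_mul _), integral_const_mul,
    integral_const_mul] at hmono
  change Real.exp a * (1 - a) * postMass N π Y + _ ≤ _ at hmono
  have hfin := hmono.trans hup
  have hea := Real.exp_pos a
  have : Real.exp a * (1 / 4 * ∫ x, ‖x‖ ^ 2 * (stdDensity x * π (Y + (√(N : ℝ))⁻¹ • x))) ≤
      Real.exp a * (a * postMass N π Y) := by linarith
  have h9 := le_of_mul_le_mul_left this hea
  rw [ha] at h9
  linarith

/-- The score grows at most polynomially in `N` and the observation. The exponents do not matter,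
only that they are finite. -/
theorem exists_norm_postScore_le : ∃ C ≥ 0, ∀ N : ℕ, 1 ≤ N → ∀ Y x : MatSpace n p,
    ‖postScore N π (Y + (√(N : ℝ))⁻¹ • x)‖ ≤
      C * (N : ℝ) ^ 2 * (1 + ‖Y‖) ^ 2 * (1 + ‖x‖) ^ 2 := by
  obtain ⟨C, hC, h⟩ := hπ.exists_second_moment_le
  refine ⟨1 + C, by positivity, fun N hN Y x => ?_⟩
  have hN1 : (1 : ℝ) ≤ N := by exact_mod_cast hN
  set Z := Y + (√(N : ℝ))⁻¹ • x with hZ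
  have hZn : 1 + ‖Z‖ ^ 2 ≤ (1 + ‖Y‖) ^ 2 * (1 + ‖x‖) ^ 2 := by
    have h1 : ‖Z‖ ≤ ‖Y‖ + ‖x‖ := (norm_add_le _ _).trans
      (by linarith [norm_inv_sqrt_smul_le hN x])
    have h2 : 1 + ‖Z‖ ≤ (1 + ‖Y‖) * (1 + ‖x‖) := by
      nlinarith [mul_nonneg (norm_nonneg Y) (norm_nonneg x)]
    calc 1 + ‖Z‖ ^ 2 ≤ (1 + ‖Z‖) ^ 2 := by nlinarith [norm_nonneg Z]
      _ ≤ ((1 + ‖Y‖) * (1 + ‖x‖)) ^ 2 := by gcongr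
      _ = _ := mul_pow _ _ _
  have hP := hπ.postMass_pos hN Z
  have hint2 : Integrable fun x => ‖x‖ ^ 2 * (stdDensity x * π (Z + (√(N : ℝ))⁻¹ • x)) := by
    have hm := hπ.measurable
    refine (hπ.integrable_pow_mul hN Z 2).mono'
      (Measurable.aestronglyMeasurable (by fun_prop)) (ae_of_all _ fun x => ?_)
    have h1 := stdDensity_pos x
    have h2 := hπ.nonneg (Z + (√(N : ℝ))⁻¹ • x)
    rw [Real.norm_of_nonneg (by positivity)]
    gcongr
    linarith
  have hnum : ‖∫ x, (stdDensity x * π (Z + (√(N : ℝ))⁻¹ • x)) • x‖ ≤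
      (1 + C * N * (1 + ‖Z‖ ^ 2)) * postMass N π Z := by
    refine (norm_integral_le_of_norm_le ((hπ.integrable_mass hN Z).add hint2)
      (ae_of_all _ fun x => ?_)).trans ?_
    · have h1 := stdDensity_pos x
      have h2 := hπ.nonneg (Z + (√(N : ℝ))⁻¹ • x)
      rw [norm_smul, Real.norm_of_nonneg (by positivity), Pi.add_apply]
      have h3 : ‖x‖ ≤ 1 + ‖x‖ ^ 2 := by nlinarith [sq_nonneg (‖x‖ - 1)]
      have h4 : 0 ≤ stdDensity x * π (Z + (√(N : ℝ))⁻¹ • x) := by positivity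
      nlinarith
    · simp only [Pi.add_apply]
      rw [integral_add (hπ.integrable_mass hN Z) hint2]
      have := h N hN Z
      change postMass N π Z + _ ≤ _
      linarith
  have hsqrt : √(N : ℝ) ≤ N := by
    rw [Real.sqrt_le_left (by positivity)]
    nlinarith
  rw [postScore, norm_smul, Real.norm_of_nonneg (by positivity)]
  calc _ ≤ (N : ℝ) * (postMass N π Z)⁻¹ * ((1 + C * N * (1 + ‖Z‖ ^ 2)) * postMass N π Z) := by
        gcongr
    _ = N * (1 + C * N * (1 + ‖Z‖ ^ 2)) := by field_simp
    _ ≤ N * (N * (1 + ‖Z‖ ^ 2) + C * N * (1 + ‖Z‖ ^ 2)) := by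
        gcongr
        nlinarith [sq_nonneg ‖Z‖]
    _ = (1 + C) * (N : ℝ) ^ 2 * (1 + ‖Z‖ ^ 2) := by ring
    _ ≤ (1 + C) * (N : ℝ) ^ 2 * ((1 + ‖Y‖) ^ 2 * (1 + ‖x‖) ^ 2) := by gcongr
    _ = _ := by ring

theorem integrable_mass_smul_shift {N : ℕ} (hN : 1 ≤ N) (Y : MatSpace n p) :
    Integrable fun x => stdDensity x •
      (π (Y + (√(N : ℝ))⁻¹ • x) • (Y + (√(N : ℝ))⁻¹ • x)) := by
  have h := ((hπ.integrable_mass hN Y).smul_const Y).add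
    ((hπ.integrable_mass_smul hN Y).smul (√(N : ℝ))⁻¹)
  refine h.congr (ae_of_all _ fun x => ?_)
  simp only [Pi.add_apply, Pi.smul_apply, smul_add, smul_smul]
  congr 2
  ring

/-- **Tweedie's formula** -/
theorem bayesEstimator_eq {N : ℕ} (hN : 1 ≤ N) (Y : MatSpace n p) :
    bayesEstimator N π Y = Y + (N : ℝ)⁻¹ • postScore N π Y := by
  have hP := hπ.postMass_pos hN Y
  have hs := sqrt_natCast_pos hN
  have hss : √(N : ℝ) * √(N : ℝ) = N := Real.mul_self_sqrt (Nat.cast_nonneg N)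
  have h1 : ∫ M, (normalDensity N Y M * π M) • M =
      postMass N π Y • Y + (√(N : ℝ))⁻¹ •
        ∫ x, (stdDensity x * π (Y + (√(N : ℝ))⁻¹ • x)) • x := by
    have h2 := integral_normalDensity_smul (fun M => π M • M) hN Y
    simp only [smul_smul] at h2
    have h3 : Integrable fun x =>
        (√(N : ℝ))⁻¹ • ((stdDensity x * π (Y + (√(N : ℝ))⁻¹ • x)) • x) :=
      (hπ.integrable_mass_smul hN Y).fun_smul _
    rw [h2, postMass, ← integral_smul_const, ← integral_smul,
      ← integral_add ((hπ.integrable_mass hN Y).smul_const Y) h3]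
    refine integral_congr_ae (ae_of_all _ fun x => ?_)
    simp only [smul_add, smul_smul]
    congr 2
    ring
  rw [bayesEstimator, h1, marginal_eq_postMass hN, postScore, smul_add, inv_smul_smul₀ hP.ne',
    smul_smul, smul_smul]
  congr 2
  rw [show (N : ℝ)⁻¹ = (√(N : ℝ))⁻¹ * (√(N : ℝ))⁻¹ by rw [← mul_inv, hss]]
  field_simp

theorem bayesWellDefined {N : ℕ} (hN : 1 ≤ N) : BayesWellDefined N π := by
  refine fun Y => ⟨(integrable_normalDensity_smul (f := π) hN Y).2 (hπ.integrable_mass hN Y),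
    marginal_eq_postMass hN π Y ▸ hπ.postMass_pos hN Y, ?_⟩
  have := (integrable_normalDensity_smul (f := fun M => π M • M) hN Y).2
    (hπ.integrable_mass_smul_shift hN Y)
  simpa only [smul_smul] using this

theorem measurable_postScore (N : ℕ) : Measurable (postScore N π) := by
  have hm := hπ.measurable
  have h1 : StronglyMeasurable (postMass N π) := by
    refine StronglyMeasurable.integral_prod_right
      (f := fun Y x => stdDensity x * π (Y + (√(N : ℝ))⁻¹ • x)) ?_
    refine Measurable.stronglyMeasurable ?_
    unfold Function.uncurry
    fun_prop
  have h2 : StronglyMeasurable fun Y =>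
      ∫ x, (stdDensity x * π (Y + (√(N : ℝ))⁻¹ • x)) • x := by
    refine StronglyMeasurable.integral_prod_right
      (f := fun Y x => (stdDensity x * π (Y + (√(N : ℝ))⁻¹ • x)) • x) ?_
    refine Measurable.stronglyMeasurable ?_
    unfold Function.uncurry
    fun_prop
  unfold postScore
  exact ((h1.measurable.inv).const_mul _).smul h2.measurable

theorem finiteRisk {N : ℕ} (hN : 1 ≤ N) (M : MatSpace n p) :
    FiniteRisk N (bayesEstimator N π) M := by
  obtain ⟨C, hC, h⟩ := hπ.exists_norm_postScore_le
  have hN1 : (1 : ℝ) ≤ N := by exact_mod_cast hN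
  have hm := hπ.measurable_postScore N
  rw [FiniteRisk, integrable_normalLaw hN]
  simp only [hπ.bayesEstimator_eq hN]
  refine integrable_stdDensity_smul_of_le (Measurable.aestronglyMeasurable (by fun_prop))
    ((1 + C * (N : ℝ) ^ 2 * (1 + ‖M‖) ^ 2) ^ 2) 4 fun x => ?_
  have h1 := h N hN M x
  have h2 := norm_inv_sqrt_smul_le hN x
  have h3 : ‖M + (√(N : ℝ))⁻¹ • x + (N : ℝ)⁻¹ • postScore N π (M + (√(N : ℝ))⁻¹ • x) - M‖ ≤
      (1 + C * (N : ℝ) ^ 2 * (1 + ‖M‖) ^ 2) * (1 + ‖x‖) ^ 2 := by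
    have h4 : ‖(N : ℝ)⁻¹ • postScore N π (M + (√(N : ℝ))⁻¹ • x)‖ ≤
        ‖postScore N π (M + (√(N : ℝ))⁻¹ • x)‖ := by
      rw [norm_smul, Real.norm_of_nonneg (by positivity)]
      exact mul_le_of_le_one_left (norm_nonneg _) (inv_le_one_of_one_le₀ hN1)
    rw [add_assoc, add_sub_cancel_left]
    have h5 := norm_add_le ((√(N : ℝ))⁻¹ • x) ((N : ℝ)⁻¹ • postScore N π (M + (√(N : ℝ))⁻¹ • x))
    have h6 : ‖x‖ ≤ (1 + ‖x‖) ^ 2 := by nlinarith [norm_nonneg x]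
    linarith
  rw [norm_pow, norm_norm]
  calc _ ≤ ((1 + C * (N : ℝ) ^ 2 * (1 + ‖M‖) ^ 2) * (1 + ‖x‖) ^ 2) ^ 2 := by gcongr
    _ = _ := by ring

end GaussianIntegrablePrior

end

/-! ### Symmetric Taylor expansion and remainder estimates -/

section

/-- A second difference is quadratically small when the derivative is Lipschitz. -/
theorem norm_second_difference_le {E G : Type*} [NormedAddCommGroup E] [NormedSpace ℝ E]
    [NormedAddCommGroup G] [NormedSpace ℝ G] {u : E → G} {u' : E → E →L[ℝ] G} {x₀ : E} {r K : ℝ}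
    (hu : ∀ y ∈ Metric.ball x₀ (2 * r), HasFDerivAt u (u' y) y)
    (hK : ∀ y ∈ Metric.ball x₀ (2 * r), ∀ z ∈ Metric.ball x₀ (2 * r),
      ‖u' y - u' z‖ ≤ K * ‖y - z‖) (hK0 : 0 ≤ K)
    {y w : E} (hy : y ∈ Metric.ball x₀ r) (hw : ‖w‖ ≤ r) :
    ‖u (y + w) + u (y - w) - (2 : ℝ) • u y‖ ≤ 2 * K * ‖w‖ ^ 2 := by
  have hmem : ∀ s : ℝ, |s| ≤ 1 → y + s • w ∈ Metric.ball x₀ (2 * r) := fun s hs => by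
    rw [Metric.mem_ball, dist_eq_norm] at hy ⊢
    have h1 : ‖s • w‖ ≤ r := by
      rw [norm_smul]
      exact (mul_le_of_le_one_left (norm_nonneg _) hs).trans hw
    calc ‖y + s • w - x₀‖ = ‖(y - x₀) + s • w‖ := by congr 1; abel
      _ ≤ ‖y - x₀‖ + ‖s • w‖ := norm_add_le _ _
      _ < 2 * r := by linarith
  have hline : ∀ s : ℝ, HasDerivAt (fun s : ℝ => y + s • w) w s := fun s => by
    simpa using ((hasDerivAt_id s).smul_const w).const_add y
  have hline' : ∀ s : ℝ, HasDerivAt (fun s : ℝ => y + (-s) • w) (-w) s := fun s => by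
    simpa using ((hasDerivAt_neg s).smul_const w).const_add y
  have h := norm_image_sub_le_of_norm_deriv_le_segment_01'
    (f := fun s : ℝ => u (y + s • w) + u (y + (-s) • w))
    (f' := fun s : ℝ => u' (y + s • w) w + u' (y + (-s) • w) (-w)) (C := 2 * K * ‖w‖ ^ 2)
    (fun s hs => (((hu _ (hmem s (by rw [abs_of_nonneg hs.1]; exact hs.2))).comp_hasDerivAt s
      (hline s)).add
      ((hu _ (hmem (-s) (by rw [abs_neg, abs_of_nonneg hs.1]; exact hs.2))).comp_hasDerivAt
        s (hline' s))).hasDerivWithinAt)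
    (fun s hs => by
      have h1 := hK _ (hmem s (by rw [abs_of_nonneg hs.1]; exact hs.2.le)) _
        (hmem (-s) (by rw [abs_neg, abs_of_nonneg hs.1]; exact hs.2.le))
      have h2 : y + s • w - (y + (-s) • w) = (2 * s) • w := by module
      rw [h2, norm_smul, Real.norm_of_nonneg (by linarith [hs.1])] at h1
      have h3 : u' (y + s • w) w + u' (y + (-s) • w) (-w) =
          (u' (y + s • w) - u' (y + (-s) • w)) w := by
        simp [sub_eq_add_neg]
      rw [h3]
      refine (ContinuousLinearMap.le_opNorm _ _).trans ?_
      have h4 : K * (2 * s * ‖w‖) ≤ 2 * K * ‖w‖ := by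
        have := mul_nonneg hK0 (norm_nonneg w)
        nlinarith [hs.1, hs.2]
      calc _ ≤ (2 * K * ‖w‖) * ‖w‖ := by gcongr; exact h1.trans h4
        _ = _ := by ring)
  simpa [two_smul, sub_eq_add_neg] using h

/-- A centered difference agrees with the derivative to third order when the derivative has
quadratically small second differences. -/
theorem norm_centered_difference_le {E : Type*} [NormedAddCommGroup E] [NormedSpace ℝ E]
    {u : E → ℝ} {u' : E → E →L[ℝ] ℝ} {x₀ : E} {r C : ℝ}
    (hu : ∀ y ∈ Metric.ball x₀ (2 * r), HasFDerivAt u (u' y) y) (hC0 : 0 ≤ C)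
    (hC : ∀ y ∈ Metric.ball x₀ r, ∀ w : E, ‖w‖ ≤ r →
      ‖u' (y + w) + u' (y - w) - (2 : ℝ) • u' y‖ ≤ C * ‖w‖ ^ 2)
    {y w : E} (hy : y ∈ Metric.ball x₀ r) (hw : ‖w‖ ≤ r) :
    ‖u (y + w) - u (y - w) - 2 * u' y w‖ ≤ C * ‖w‖ ^ 3 := by
  have hsw : ∀ s : ℝ, |s| ≤ 1 → ‖s • w‖ ≤ ‖w‖ := fun s hs => by
    rw [norm_smul]
    exact mul_le_of_le_one_left (norm_nonneg _) hs
  have hmem : ∀ s : ℝ, |s| ≤ 1 → y + s • w ∈ Metric.ball x₀ (2 * r) := fun s hs => by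
    rw [Metric.mem_ball, dist_eq_norm] at hy ⊢
    calc ‖y + s • w - x₀‖ = ‖(y - x₀) + s • w‖ := by congr 1; abel
      _ ≤ ‖y - x₀‖ + ‖s • w‖ := norm_add_le _ _
      _ < 2 * r := by linarith [hsw s hs]
  have hline : ∀ s : ℝ, HasDerivAt (fun s : ℝ => y + s • w) w s := fun s => by
    simpa using ((hasDerivAt_id s).smul_const w).const_add y
  have hline' : ∀ s : ℝ, HasDerivAt (fun s : ℝ => y + (-s) • w) (-w) s := fun s => by
    simpa using ((hasDerivAt_neg s).smul_const w).const_add y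
  have h := norm_image_sub_le_of_norm_deriv_le_segment_01'
    (f := fun s : ℝ => u (y + s • w) - u (y + (-s) • w) - s * (2 * u' y w))
    (f' := fun s : ℝ => u' (y + s • w) w - u' (y + (-s) • w) (-w) - 1 * (2 * u' y w))
    (C := C * ‖w‖ ^ 3)
    (fun s hs => ((((hu _ (hmem s (by rw [abs_of_nonneg hs.1]; exact hs.2))).comp_hasDerivAt s
      (hline s)).sub
      ((hu _ (hmem (-s) (by rw [abs_neg, abs_of_nonneg hs.1]; exact hs.2))).comp_hasDerivAt
        s (hline' s))).sub ((hasDerivAt_id s).mul_const _)).hasDerivWithinAt)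
    (fun s hs => by
      have hs1 : |s| ≤ 1 := by rw [abs_of_nonneg hs.1]; exact hs.2.le
      have h1 := hC y hy (s • w) ((hsw s hs1).trans hw)
      have h3 : u' (y + s • w) w - u' (y + (-s) • w) (-w) - 1 * (2 * u' y w) =
          (u' (y + s • w) + u' (y - s • w) - (2 : ℝ) • u' y) w := by
        simp [sub_eq_add_neg]
      rw [h3]
      refine (ContinuousLinearMap.le_opNorm _ _).trans ?_
      calc _ ≤ (C * ‖w‖ ^ 2) * ‖w‖ := by
            gcongr
            refine h1.trans ?_
            gcongr
            exact hsw s hs1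
        _ = _ := by ring)
  simpa [sub_eq_add_neg] using h

/-- The symmetric second difference and the centered difference of a `C³` function, with bounds
that are uniform in the base point. -/
theorem exists_symmetric_taylor {E : Type*} [NormedAddCommGroup E] [NormedSpace ℝ E] {f : E → ℝ}
    {x₀ : E} (hf : ContDiffAt ℝ 3 f x₀) :
    ∃ r₀ > 0, ∃ L ≥ 0, ∀ r > 0, r ≤ r₀ → ∀ y ∈ Metric.ball x₀ r, ∀ w : E, ‖w‖ ≤ r →
      |f (y + w) + f (y - w) - 2 * f y| ≤ L * ‖w‖ ^ 2 ∧
      |f (y + w) - f (y - w) - 2 * fderiv ℝ f y w| ≤ L * ‖w‖ ^ 3 := by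
  have hf1 : ContDiffAt ℝ 2 (fderiv ℝ f) x₀ := hf.fderiv_right (by norm_num)
  have hf2 : ContDiffAt ℝ 1 (fderiv ℝ (fderiv ℝ f)) x₀ := hf1.fderiv_right (by norm_num)
  obtain ⟨K₁, t₁, ht₁, hK₁⟩ := (hf1.of_le (by norm_num)).exists_lipschitzOnWith
  obtain ⟨K₂, t₂, ht₂, hK₂⟩ := hf2.exists_lipschitzOnWith
  have hd : ∀ᶠ y in 𝓝 x₀, DifferentiableAt ℝ f y :=
    (hf.eventually (by simp)).mono fun y hy => hy.differentiableAt (by norm_num)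
  have hd1 : ∀ᶠ y in 𝓝 x₀, DifferentiableAt ℝ (fderiv ℝ f) y :=
    (hf1.eventually (by simp)).mono fun y hy => hy.differentiableAt (by norm_num)
  obtain ⟨R, hR, hball⟩ := Metric.eventually_nhds_iff_ball.1
    ((hd.and hd1).and ((eventually_mem_set.2 ht₁).and (eventually_mem_set.2 ht₂)))
  refine ⟨R / 2, by positivity, 2 * K₁ + 2 * K₂, by positivity, fun r hr hrR y hy w hw => ?_⟩
  have hsub : ∀ z ∈ Metric.ball x₀ (2 * r), z ∈ Metric.ball x₀ R := fun z hz =>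
    Metric.ball_subset_ball (by linarith) hz
  have h1 := norm_second_difference_le (u := f) (u' := fderiv ℝ f) (x₀ := x₀) (r := r) (K := K₁)
    (fun z hz => (hball z (hsub z hz)).1.1.hasFDerivAt)
    (fun a ha b hb => by
      simpa [dist_eq_norm] using
        hK₁.dist_le_mul a (hball a (hsub a ha)).2.1 b (hball b (hsub b hb)).2.1)
    K₁.2 hy hw
  have h2 := norm_centered_difference_le (u := f) (u' := fderiv ℝ f) (x₀ := x₀) (r := r)
    (C := 2 * K₂) (fun z hz => (hball z (hsub z hz)).1.1.hasFDerivAt) (by positivity)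
    (fun z hz v hv => norm_second_difference_le (u := fderiv ℝ f) (u' := fderiv ℝ (fderiv ℝ f))
      (x₀ := x₀) (r := r) (K := K₂) (fun z hz => (hball z (hsub z hz)).1.2.hasFDerivAt)
      (fun a ha b hb => by
        simpa [dist_eq_norm] using
          hK₂.dist_le_mul a (hball a (hsub a ha)).2.2 b (hball b (hsub b hb)).2.2)
      K₂.2 hz hv) hy hw
  rw [Real.norm_eq_abs] at h1 h2
  refine ⟨h1.trans ?_, h2.trans ?_⟩
  · have : (0 : ℝ) ≤ K₂ * ‖w‖ ^ 2 := by positivity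
    nlinarith
  · have : (0 : ℝ) ≤ K₁ * ‖w‖ ^ 3 := by positivity
    nlinarith

theorem exists_sqrt_pow_mul_exp_neg_le (k : ℕ) {c : ℝ} (hc : 0 < c) :
    ∃ C ≥ 0, ∀ N : ℕ, 1 ≤ N → √(N : ℝ) ^ k * Real.exp (-c * N) ≤ C / N := by
  refine ⟨Real.exp (((k + 2 : ℕ) : ℝ) ^ 2 / (4 * c)), by positivity, fun N hN => ?_⟩
  have hs := sqrt_natCast_pos hN
  have hss : √(N : ℝ) ^ 2 = N := Real.sq_sqrt (Nat.cast_nonneg N)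
  have h := one_add_pow_le_exp_sq (k + 2) hc hs.le
  have h2 : √(N : ℝ) ^ (k + 2) ≤ (1 + √(N : ℝ)) ^ (k + 2) := by gcongr; linarith
  rw [le_div_iff₀ (by rw [← hss]; positivity)]
  calc √(N : ℝ) ^ k * Real.exp (-c * N) * N = √(N : ℝ) ^ (k + 2) * Real.exp (-c * N) := by
        rw [pow_add, hss]; ring
    _ ≤ (Real.exp (((k + 2 : ℕ) : ℝ) ^ 2 / (4 * c)) * Real.exp (c * √(N : ℝ) ^ 2)) *
        Real.exp (-c * N) := by gcongr; exact h2.trans h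
    _ = _ := by
      rw [hss, mul_assoc, ← Real.exp_add, show c * (N : ℝ) + -c * N = 0 by ring, Real.exp_zero,
        mul_one]

variable {n p : ℕ}

theorem norm_inv_sqrt_smul_sq {N : ℕ} (x : MatSpace n p) :
    ‖(√(N : ℝ))⁻¹ • x‖ ^ 2 = ‖x‖ ^ 2 / N := by
  rw [norm_smul, mul_pow, Real.norm_of_nonneg (by positivity), inv_pow,
    Real.sq_sqrt (Nat.cast_nonneg N)]
  ring

/-- Outside a ball whose radius is fixed on the original scale, the standard normal density is
exponentially small in `N`, with enough left over to integrate the prior. -/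
theorem exists_stdDensity_tail_le (n p : ℕ) {r : ℝ} (hr : 0 < r) : ∃ C ≥ 0, ∀ N : ℕ, 1 ≤ N →
    ∀ x : MatSpace n p, r ≤ ‖(√(N : ℝ))⁻¹ • x‖ → (1 + ‖x‖) * stdDensity x ≤
      C * Real.exp (-(r ^ 2 / 8) * N) * Real.exp (-(1 / 4) * ‖(√(N : ℝ))⁻¹ • x‖ ^ 2) := by
  obtain ⟨C, hC, h⟩ := exists_one_add_norm_pow_mul_stdDensity_le n p 1
  refine ⟨C, hC, fun N hN x hx => ?_⟩
  have hN0 : (0 : ℝ) < N := by exact_mod_cast hN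
  have h1 := h x
  rw [pow_one] at h1
  refine h1.trans ?_
  rw [mul_assoc, ← Real.exp_add]
  refine mul_le_mul_of_nonneg_left (Real.exp_le_exp.2 ?_) hC
  have h2 := pow_le_pow_left₀ hr.le hx 2
  have h3 := pow_le_pow_left₀ (norm_nonneg _) (norm_inv_sqrt_smul_le hN x) 2
  rw [norm_inv_sqrt_smul_sq, le_div_iff₀ hN0] at h2
  linarith

theorem integral_stdDensity_smul_comp_neg {F : Type*} [NormedAddCommGroup F] [NormedSpace ℝ F]
    (f : MatSpace n p → F) :
    ∫ x, stdDensity x • f (-x) = ∫ x, stdDensity x • f x := by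
  rw [← integral_neg_eq_self (fun x => stdDensity x • f x)]
  simp

namespace GaussianIntegrablePrior

variable {π : MatSpace n p → ℝ} (hπ : GaussianIntegrablePrior π)
include hπ

/-- A Gaussian integral is of order `1 / N` if its integrand is of order `1 / N` on a ball whose
radius is fixed on the original scale, and bounded by the prior off it. -/
theorem exists_norm_integral_remainder_le (F : Type*) [NormedAddCommGroup F] [NormedSpace ℝ F]
    (M₀ : MatSpace n p) {r D : ℝ} (hr : 0 < r) (hD : 0 ≤ D) :
    ∃ C ≥ 0, ∀ N : ℕ, 1 ≤ N → ∀ Y ∈ Metric.ball M₀ r, ∀ g : MatSpace n p → F,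
      (∀ x, ‖(√(N : ℝ))⁻¹ • x‖ ≤ r → ‖g x‖ ≤ D / N * (1 + ‖x‖) ^ 4) →
      (∀ x, r ≤ ‖(√(N : ℝ))⁻¹ • x‖ → ‖g x‖ ≤ D / N * (1 + ‖x‖) ^ 4 + √(N : ℝ) * (1 + ‖x‖) *
        (π (Y + (√(N : ℝ))⁻¹ • x) + π (Y + (√(N : ℝ))⁻¹ • -x))) →
      ‖∫ x, stdDensity x • g x‖ ≤ C / N := by
  obtain ⟨C₁, hC₁, htail⟩ := exists_stdDensity_tail_le n p hr
  obtain ⟨C₂, hC₂, hpow⟩ := exists_sqrt_pow_mul_exp_neg_le (n * p + 1)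
    (show 0 < r ^ 2 / 8 by positivity)
  set I := ∫ M, π M * Real.exp (-(1 / 8) * ‖M‖ ^ 2) with hI
  have hI0 : 0 ≤ I := integral_nonneg fun M => mul_nonneg (hπ.nonneg M) (Real.exp_nonneg _)
  set m := ∫ x : MatSpace n p, stdDensity x * (1 + ‖x‖) ^ 4 with hm
  have hm0 : 0 ≤ m := integral_nonneg fun x => mul_nonneg (stdDensity_pos x).le (by positivity)
  set B := Real.exp (1 / 4 * (‖M₀‖ + r) ^ 2) with hB
  refine ⟨D * m + 2 * C₁ * B * I * C₂, by positivity, fun N hN Y hY g hg₁ hg₂ => ?_⟩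
  have hN0 : (0 : ℝ) < N := by exact_mod_cast hN
  have hYn : ‖Y‖ ≤ ‖M₀‖ + r := by
    have := norm_le_norm_add_norm_sub' Y M₀
    rw [← dist_eq_norm] at this
    linarith [Metric.mem_ball.1 hY]
  set q : MatSpace n p → ℝ := fun x =>
    Real.exp (-(1 / 4) * ‖(√(N : ℝ))⁻¹ • x‖ ^ 2) * π (Y + (√(N : ℝ))⁻¹ • x) with hq
  have hq0 : ∀ x, 0 ≤ q x := fun x => mul_nonneg (Real.exp_nonneg _) (hπ.nonneg _)
  have hqint : Integrable q := hπ.integrable_exp_mul_scaled hN Y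
  have hqint' : Integrable fun x => q (-x) := hqint.comp_neg
  set T := √(N : ℝ) * (C₁ * Real.exp (-(r ^ 2 / 8) * N)) with hT
  have hT0 : 0 ≤ T := by positivity
  have hbound : ∀ x, ‖stdDensity x • g x‖ ≤
      D / N * (stdDensity x * (1 + ‖x‖) ^ 4) + T * (q x + q (-x)) := by
    intro x
    have hφ := stdDensity_pos x
    rw [norm_smul, Real.norm_of_nonneg hφ.le]
    rcases le_total ‖(√(N : ℝ))⁻¹ • x‖ r with h | h
    · have := mul_nonneg hT0 (add_nonneg (hq0 x) (hq0 (-x)))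
      calc _ ≤ stdDensity x * (D / N * (1 + ‖x‖) ^ 4) := by gcongr; exact hg₁ x h
        _ = D / N * (stdDensity x * (1 + ‖x‖) ^ 4) := by ring
        _ ≤ _ := by linarith
    · have h1 := htail N hN x h
      have h2 := hπ.nonneg (Y + (√(N : ℝ))⁻¹ • x)
      have h3 := hπ.nonneg (Y + (√(N : ℝ))⁻¹ • -x)
      calc _ ≤ stdDensity x * (D / N * (1 + ‖x‖) ^ 4 + √(N : ℝ) * (1 + ‖x‖) *
            (π (Y + (√(N : ℝ))⁻¹ • x) + π (Y + (√(N : ℝ))⁻¹ • -x))) := by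
            gcongr; exact hg₂ x h
        _ = D / N * (stdDensity x * (1 + ‖x‖) ^ 4) + √(N : ℝ) * ((1 + ‖x‖) * stdDensity x) *
            (π (Y + (√(N : ℝ))⁻¹ • x) + π (Y + (√(N : ℝ))⁻¹ • -x)) := by ring
        _ ≤ D / N * (stdDensity x * (1 + ‖x‖) ^ 4) + √(N : ℝ) *
            (C₁ * Real.exp (-(r ^ 2 / 8) * N) *
              Real.exp (-(1 / 4) * ‖(√(N : ℝ))⁻¹ • x‖ ^ 2)) *
            (π (Y + (√(N : ℝ))⁻¹ • x) + π (Y + (√(N : ℝ))⁻¹ • -x)) := by gcongr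
        _ = _ := by
          simp only [hq, hT, smul_neg, norm_neg]
          ring
  have hint1 := (integrable_stdDensity_mul_pow (n := n) (p := p) 4).const_mul (D / N)
  have hint2 : Integrable fun x => T * (q x + q (-x)) := (hqint.add hqint').const_mul T
  refine (norm_integral_le_of_norm_le (hint1.add hint2) (ae_of_all _ hbound)).trans ?_
  simp only [Pi.add_apply]
  rw [integral_add hint1 hint2, integral_const_mul, integral_const_mul,
    integral_add hqint hqint', integral_neg_eq_self q]
  have hBY : Real.exp (1 / 4 * ‖Y‖ ^ 2) ≤ B := Real.exp_le_exp.2 (by gcongr)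
  have hqle : ∫ x, q x ≤ √(N : ℝ) ^ (n * p) * (B * I) := by
    refine (hπ.integral_exp_mul_scaled_le hN Y).trans ?_
    gcongr
  have hp := hpow N hN
  calc D / N * m + T * ((∫ x, q x) + ∫ x, q x)
      ≤ D / N * m + T * (√(N : ℝ) ^ (n * p) * (B * I) + √(N : ℝ) ^ (n * p) * (B * I)) := by gcongr
    _ = D / N * m + 2 * C₁ * B * I *
        (√(N : ℝ) ^ (n * p + 1) * Real.exp (-(r ^ 2 / 8) * N)) := by
        rw [hT, pow_succ]; ring
    _ ≤ D / N * m + 2 * C₁ * B * I * (C₂ / N) := by gcongr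
    _ = _ := by ring

end GaussianIntegrablePrior

end

/-! ### Convergence of the score -/

section

variable {n p : ℕ}

namespace GaussianIntegrablePrior

variable {π : MatSpace n p → ℝ} (hπ : GaussianIntegrablePrior π)
include hπ

/-- The marginal density differs from the prior density by `O(1 / N)`, because the prior is averaged
over `x` and `-x` and its second differences are quadratically small. -/
theorem exists_postMass_sub_le {M₀ : MatSpace n p} {r L B : ℝ} (hr : 0 < r) (hL0 : 0 ≤ L)
    (hL : ∀ Y ∈ Metric.ball M₀ r, ∀ w : MatSpace n p, ‖w‖ ≤ r →
      |π (Y + w) + π (Y - w) - 2 * π Y| ≤ L * ‖w‖ ^ 2)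
    (hB : ∀ Y ∈ Metric.ball M₀ r, π Y ≤ B) :
    ∃ C ≥ 0, ∀ N : ℕ, 1 ≤ N → ∀ Y ∈ Metric.ball M₀ r, |postMass N π Y - π Y| ≤ C / N := by
  have hB0 : 0 ≤ B := (hπ.nonneg M₀).trans (hB M₀ (Metric.mem_ball_self hr))
  obtain ⟨C, hC, h⟩ := hπ.exists_norm_integral_remainder_le ℝ M₀ (D := L + 2 * B / r ^ 2) hr
    (by positivity)
  refine ⟨C, hC, fun N hN Y hY => ?_⟩
  have hN0 : (0 : ℝ) < N := by exact_mod_cast hN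
  have hpoly : ∀ x : MatSpace n p, ‖x‖ ^ 2 ≤ (1 + ‖x‖) ^ 4 := fun x => by
    have h0 := norm_nonneg x
    calc ‖x‖ ^ 2 ≤ (1 + ‖x‖) ^ 2 := by gcongr; linarith
      _ ≤ (1 + ‖x‖) ^ 4 := pow_le_pow_right₀ (by linarith) (by norm_num)
  have hBr : 0 ≤ 2 * B / r ^ 2 := by positivity
  have key := h N hN Y hY
    (fun x => π (Y + (√(N : ℝ))⁻¹ • x) + π (Y + (√(N : ℝ))⁻¹ • -x) - 2 * π Y)
    (fun x hx => by
      have h1 := hL Y hY _ hx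
      rw [norm_inv_sqrt_smul_sq] at h1
      rw [Real.norm_eq_abs, smul_neg, ← sub_eq_add_neg]
      refine h1.trans ?_
      calc L * (‖x‖ ^ 2 / N) = L / N * ‖x‖ ^ 2 := by ring
        _ ≤ (L + 2 * B / r ^ 2) / N * (1 + ‖x‖) ^ 4 := by
          gcongr
          · linarith
          · exact hpoly x)
    (fun x hx => by
      have h1 := pow_le_pow_left₀ hr.le hx 2
      rw [norm_inv_sqrt_smul_sq] at h1
      have hP := hπ.nonneg (Y + (√(N : ℝ))⁻¹ • x)
      have hP' := hπ.nonneg (Y + (√(N : ℝ))⁻¹ • -x)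
      have hPY := hπ.nonneg Y
      set P := π (Y + (√(N : ℝ))⁻¹ • x) + π (Y + (√(N : ℝ))⁻¹ • -x) with hPdef
      have hsum : 0 ≤ P := add_nonneg hP hP'
      have h2 : 1 ≤ √(N : ℝ) * (1 + ‖x‖) :=
        one_le_mul_of_one_le_of_one_le (Real.one_le_sqrt.2 (by exact_mod_cast hN))
          (by linarith [norm_nonneg x])
      have h3 : 2 * π Y ≤ (L + 2 * B / r ^ 2) / N * (1 + ‖x‖) ^ 4 := by
        calc 2 * π Y ≤ 2 * B * 1 := by linarith [hB Y hY]
          _ ≤ 2 * B * ((‖x‖ ^ 2 / N) / r ^ 2) := by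
            gcongr
            rwa [one_le_div (by positivity)]
          _ = 2 * B / r ^ 2 / N * ‖x‖ ^ 2 := by ring
          _ ≤ _ := by
            gcongr
            · linarith
            · exact hpoly x
      rw [Real.norm_eq_abs, abs_le]
      have h4 : P ≤ √(N : ℝ) * (1 + ‖x‖) * P := le_mul_of_one_le_left hsum h2
      constructor <;> linarith)
  have hi1 := hπ.integrable_mass hN Y
  have hi2 : Integrable fun x => stdDensity x * π (Y + (√(N : ℝ))⁻¹ • -x) := by
    simpa using hi1.comp_neg
  have hi3 : Integrable fun x : MatSpace n p => stdDensity x * (2 * π Y) := by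
    simpa using (integrable_stdDensity_mul_pow (n := n) (p := p) 0).mul_const (2 * π Y)
  have hi12 : Integrable fun x => stdDensity x * π (Y + (√(N : ℝ))⁻¹ • x) +
      stdDensity x * π (Y + (√(N : ℝ))⁻¹ • -x) := hi1.add hi2
  have heq : ∫ x, stdDensity x • (π (Y + (√(N : ℝ))⁻¹ • x) + π (Y + (√(N : ℝ))⁻¹ • -x) -
      2 * π Y) = 2 * (postMass N π Y - π Y) := by
    simp only [smul_eq_mul, mul_sub, mul_add]
    rw [integral_sub hi12 hi3, integral_add hi1 hi2, integral_mul_const, integral_stdDensity]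
    have := integral_stdDensity_smul_comp_neg fun x : MatSpace n p => π (Y + (√(N : ℝ))⁻¹ • x)
    simp only [smul_eq_mul] at this
    rw [this, postMass]
    ring
  rw [heq, norm_mul, Real.norm_eq_abs, Real.norm_eq_abs, abs_two] at key
  linarith [abs_nonneg (postMass N π Y - π Y)]

/-- The gradient of the marginal density differs from the gradient `V` of the prior density by
`O(1 / N)`, because centered differences approximate the derivative to third order. -/
theorem exists_score_numerator_sub_le {M₀ : MatSpace n p} {r L B : ℝ} (hr : 0 < r) (hL0 : 0 ≤ L)
    {V : MatSpace n p → MatSpace n p}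
    (hL : ∀ Y ∈ Metric.ball M₀ r, ∀ w : MatSpace n p, ‖w‖ ≤ r →
      |π (Y + w) - π (Y - w) - 2 * inner ℝ (V Y) w| ≤ L * ‖w‖ ^ 3)
    (hB : ∀ Y ∈ Metric.ball M₀ r, ‖V Y‖ ≤ B) :
    ∃ C ≥ 0, ∀ N : ℕ, 1 ≤ N → ∀ Y ∈ Metric.ball M₀ r,
      ‖√(N : ℝ) • (∫ x, (stdDensity x * π (Y + (√(N : ℝ))⁻¹ • x)) • x) - V Y‖ ≤ C / N := by
  have hB0 : 0 ≤ B := (norm_nonneg _).trans (hB M₀ (Metric.mem_ball_self hr))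
  obtain ⟨C, hC, h⟩ := hπ.exists_norm_integral_remainder_le (MatSpace n p) M₀
    (D := L + 2 * B / r ^ 2) hr (by positivity)
  refine ⟨C, hC, fun N hN Y hY => ?_⟩
  have hN0 : (0 : ℝ) < N := by exact_mod_cast hN
  have hs := sqrt_natCast_pos hN
  have hss : √(N : ℝ) ^ 2 = N := Real.sq_sqrt (Nat.cast_nonneg N)
  have hBr : 0 ≤ 2 * B / r ^ 2 := by positivity
  have hhx : ∀ x : MatSpace n p, ‖(√(N : ℝ))⁻¹ • x‖ = (√(N : ℝ))⁻¹ * ‖x‖ := fun x => by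
    rw [norm_smul, Real.norm_of_nonneg (by positivity)]
  set e : MatSpace n p → ℝ := fun x => √(N : ℝ) * (π (Y + (√(N : ℝ))⁻¹ • x) -
    π (Y + (√(N : ℝ))⁻¹ • -x) - 2 * inner ℝ (V Y) ((√(N : ℝ))⁻¹ • x)) with he
  have key := h N hN Y hY (fun x => e x • x)
    (fun x hx => by
      have h1 := hL Y hY _ hx
      rw [hhx] at h1
      have h2 : |e x| ≤ √(N : ℝ) * (L * ((√(N : ℝ))⁻¹ * ‖x‖) ^ 3) := by
        simp only [he]
        rw [abs_mul, abs_of_pos hs, smul_neg, ← sub_eq_add_neg]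
        gcongr
      rw [norm_smul, Real.norm_eq_abs]
      calc |e x| * ‖x‖ ≤ √(N : ℝ) * (L * ((√(N : ℝ))⁻¹ * ‖x‖) ^ 3) * ‖x‖ := by gcongr
        _ = L * (√(N : ℝ) * (√(N : ℝ))⁻¹) * (√(N : ℝ) ^ 2)⁻¹ * ‖x‖ ^ 4 := by ring
        _ = L / N * ‖x‖ ^ 4 := by rw [mul_inv_cancel₀ hs.ne', hss]; ring
        _ ≤ (L + 2 * B / r ^ 2) / N * (1 + ‖x‖) ^ 4 := by
          gcongr
          · linarith
          · linarith)
    (fun x hx => by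
      have h1 := pow_le_pow_left₀ hr.le hx 2
      rw [norm_inv_sqrt_smul_sq] at h1
      have hP := hπ.nonneg (Y + (√(N : ℝ))⁻¹ • x)
      have hP' := hπ.nonneg (Y + (√(N : ℝ))⁻¹ • -x)
      have hV := hB Y hY
      have h2 : |e x| ≤ √(N : ℝ) * (π (Y + (√(N : ℝ))⁻¹ • x) + π (Y + (√(N : ℝ))⁻¹ • -x)) +
          2 * B * ‖x‖ := by
        have hin : |inner ℝ (V Y) ((√(N : ℝ))⁻¹ • x)| ≤ B * ((√(N : ℝ))⁻¹ * ‖x‖) := by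
          rw [← hhx]
          exact (abs_real_inner_le_norm _ _).trans (by gcongr)
        have h3 : √(N : ℝ) * (2 * (B * ((√(N : ℝ))⁻¹ * ‖x‖))) = 2 * B * ‖x‖ := by
          field_simp
        rw [← h3, ← mul_add]
        simp only [he]
        rw [abs_mul, abs_of_pos hs]
        refine mul_le_mul_of_nonneg_left ?_ hs.le
        rw [abs_le] at hin ⊢
        constructor <;> linarith [hin.1, hin.2]
      have h4 : 2 * B * ‖x‖ * ‖x‖ ≤ (L + 2 * B / r ^ 2) / N * (1 + ‖x‖) ^ 4 := by
        calc 2 * B * ‖x‖ * ‖x‖ = 2 * B * ‖x‖ ^ 2 * 1 := by ring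
          _ ≤ 2 * B * ‖x‖ ^ 2 * ((‖x‖ ^ 2 / N) / r ^ 2) := by
            gcongr
            rwa [one_le_div (by positivity)]
          _ = 2 * B / r ^ 2 / N * ‖x‖ ^ 4 := by ring
          _ ≤ _ := by
            gcongr
            · linarith
            · linarith
      rw [norm_smul, Real.norm_eq_abs]
      calc |e x| * ‖x‖ ≤ (√(N : ℝ) * (π (Y + (√(N : ℝ))⁻¹ • x) + π (Y + (√(N : ℝ))⁻¹ • -x)) +
          2 * B * ‖x‖) * ‖x‖ := by gcongr
        _ = 2 * B * ‖x‖ * ‖x‖ + √(N : ℝ) * ‖x‖ *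
          (π (Y + (√(N : ℝ))⁻¹ • x) + π (Y + (√(N : ℝ))⁻¹ • -x)) := by ring
        _ ≤ _ := by
          gcongr
          linarith)
  have hi1 := hπ.integrable_mass_smul hN Y
  have hi1' : Integrable fun x => stdDensity x • (√(N : ℝ) • π (Y + (√(N : ℝ))⁻¹ • x) • x) := by
    refine (hi1.fun_smul √(N : ℝ)).congr (ae_of_all _ fun x => ?_)
    simp only [smul_smul]
    congr 1
    ring
  have hi2 : Integrable fun x => stdDensity x •
      (√(N : ℝ) • π (Y + (√(N : ℝ))⁻¹ • -x) • -x) := by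
    simpa using hi1'.comp_neg
  have hi3 : Integrable fun x : MatSpace n p =>
      stdDensity x • ((2 : ℝ) • (inner ℝ (V Y) x : ℝ) • x) := by
    refine integrable_stdDensity_smul_of_le (by fun_prop) (2 * ‖V Y‖) 2 fun x => ?_
    have h5 := norm_inner_le_norm (𝕜 := ℝ) (V Y) x
    have h0 := norm_nonneg x
    rw [norm_smul, norm_smul, Real.norm_of_nonneg zero_le_two]
    calc _ ≤ 2 * ((‖V Y‖ * ‖x‖) * ‖x‖) := by gcongr
      _ = 2 * ‖V Y‖ * ‖x‖ ^ 2 := by ring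
      _ ≤ _ := by gcongr; linarith
  have hi12 : Integrable fun x => stdDensity x • (√(N : ℝ) • π (Y + (√(N : ℝ))⁻¹ • x) • x) +
      stdDensity x • (√(N : ℝ) • π (Y + (√(N : ℝ))⁻¹ • -x) • -x) := hi1'.add hi2
  have heq : ∫ x, stdDensity x • (e x • x) =
      (2 : ℝ) • (√(N : ℝ) • (∫ x, (stdDensity x * π (Y + (√(N : ℝ))⁻¹ • x)) • x) - V Y) := by
    have h6 : ∀ x, stdDensity x • (e x • x) =
        stdDensity x • (√(N : ℝ) • π (Y + (√(N : ℝ))⁻¹ • x) • x) +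
        stdDensity x • (√(N : ℝ) • π (Y + (√(N : ℝ))⁻¹ • -x) • -x) -
        stdDensity x • ((2 : ℝ) • (inner ℝ (V Y) x : ℝ) • x) := fun x => by
      have h7 : √(N : ℝ) * (2 * ((√(N : ℝ))⁻¹ * inner ℝ (V Y) x)) = 2 * inner ℝ (V Y) x := by
        field_simp
      simp only [he, inner_smul_right, mul_sub, h7]
      module
    simp only [h6]
    have h8 := integral_stdDensity_smul_comp_neg
      fun x : MatSpace n p => √(N : ℝ) • π (Y + (√(N : ℝ))⁻¹ • x) • x
    have h9 : ∫ x : MatSpace n p, stdDensity x • ((2 : ℝ) • (inner ℝ (V Y) x : ℝ) • x) =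
        (2 : ℝ) • V Y := by
      rw [← integral_stdDensity_inner_smul (V Y), ← integral_smul]
      refine integral_congr_ae (ae_of_all _ fun x => ?_)
      simp only [integral_stdDensity_inner_smul]
      exact smul_comm _ _ _
    have h10 : ∫ x, stdDensity x • (√(N : ℝ) • π (Y + (√(N : ℝ))⁻¹ • x) • x) =
        √(N : ℝ) • ∫ x, (stdDensity x * π (Y + (√(N : ℝ))⁻¹ • x)) • x := by
      rw [← integral_smul]
      refine integral_congr_ae (ae_of_all _ fun x => ?_)
      simp only [smul_smul]
      congr 1
      ring
    rw [integral_sub hi12 hi3, integral_add hi1' hi2, h8, h9, h10, smul_sub, two_smul, two_smul]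
  rw [heq, norm_smul, Real.norm_of_nonneg zero_le_two] at key
  linarith [norm_nonneg (√(N : ℝ) • (∫ x, (stdDensity x * π (Y + (√(N : ℝ))⁻¹ • x)) • x) - V Y)]

/-- Locally uniformly, the score of the marginal density differs from the logarithmic gradient of
the prior by `O(1 / N)`. -/
theorem exists_postScore_sub_le {M₀ : MatSpace n p} (hsmooth : ContDiffAt ℝ 3 π M₀)
    (hpos : 0 < π M₀) {G : MatSpace n p → MatSpace n p}
    (hG : ∀ᶠ Y in 𝓝 M₀, HasGradientAt π (π Y • G Y) Y) (hGc : ContinuousAt G M₀) :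
    ∃ r > 0, ∃ C ≥ 0, ∀ᶠ N : ℕ in atTop, ∀ Y ∈ Metric.ball M₀ r,
      ‖postScore N π Y - G Y‖ ≤ C / N := by
  obtain ⟨r₀, hr₀, L, hL, htaylor⟩ := exists_symmetric_taylor hsmooth
  set c := π M₀ with hc
  set b := ‖G M₀‖ + 1 with hb
  have hb0 : 0 < b := by positivity
  have hev1 : ∀ᶠ Y in 𝓝 M₀, c / 2 < π Y := hsmooth.continuousAt.eventually
    (lt_mem_nhds (by linarith))
  have hev2 : ∀ᶠ Y in 𝓝 M₀, π Y < 2 * c := hsmooth.continuousAt.eventually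
    (gt_mem_nhds (by linarith))
  have hev3 : ∀ᶠ Y in 𝓝 M₀, ‖G Y‖ < b := hGc.norm.eventually (gt_mem_nhds (by linarith))
  obtain ⟨r₁, hr₁, hball⟩ := Metric.eventually_nhds_iff_ball.1
    ((hev1.and hev2).and (hev3.and hG))
  set r := min r₀ r₁ with hr
  have hr0 : 0 < r := lt_min hr₀ hr₁
  have hb' : ∀ Y ∈ Metric.ball M₀ r, Y ∈ Metric.ball M₀ r₁ := fun Y hY =>
    Metric.ball_subset_ball (min_le_right _ _) hY
  obtain ⟨C₁, hC₁, h₁⟩ := hπ.exists_postMass_sub_le hr0 hL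
    (fun Y hY w hw => (htaylor r hr0 (min_le_left _ _) Y hY w hw).1)
    (B := 2 * c) (fun Y hY => (hball Y (hb' Y hY)).1.2.le)
  obtain ⟨C₂, hC₂, h₂⟩ := hπ.exists_score_numerator_sub_le hr0 hL (V := fun Y => π Y • G Y)
    (fun Y hY w hw => by
      have h := (htaylor r hr0 (min_le_left _ _) Y hY w hw).2
      rwa [(hball Y (hb' Y hY)).2.2.hasFDerivAt.fderiv, InnerProductSpace.toDual_apply_apply] at h)
    (B := 2 * c * b) (fun Y hY => by
      have h := hball Y (hb' Y hY)
      rw [norm_smul, Real.norm_of_nonneg (hπ.nonneg Y)]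
      exact mul_le_mul h.1.2.le h.2.1.le (norm_nonneg _) (by positivity))
  refine ⟨r, hr0, 4 / c * (C₂ + C₁ * b), by positivity, ?_⟩
  have hlarge : ∀ᶠ N : ℕ in atTop, C₁ / N < c / 4 :=
    (tendsto_const_div_atTop_nhds_zero_nat C₁).eventually (gt_mem_nhds (by positivity))
  filter_upwards [hlarge, eventually_ge_atTop 1] with N hNl hN Y hY
  have hN0 : (0 : ℝ) < N := by exact_mod_cast hN
  have hm := h₁ N hN Y hY
  have ha := h₂ N hN Y hY
  have hY' := hball Y (hb' Y hY)
  have hmlow : c / 4 < postMass N π Y := by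
    have := (abs_le.1 hm).1
    linarith [hY'.1.1]
  have hmpos : 0 < postMass N π Y := lt_trans (by positivity) hmlow
  set a := √(N : ℝ) • (∫ x, (stdDensity x * π (Y + (√(N : ℝ))⁻¹ • x)) • x) with hadef
  have heq : postScore N π Y - G Y = (postMass N π Y)⁻¹ •
      ((a - π Y • G Y) - (postMass N π Y - π Y) • G Y) := by
    have h1 : postScore N π Y = (postMass N π Y)⁻¹ • a := by
      rw [hadef, smul_smul, postScore, mul_comm]
    have h2 : (a - π Y • G Y) - (postMass N π Y - π Y) • G Y = a - postMass N π Y • G Y := by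
      rw [sub_smul]; abel
    rw [h1, h2, smul_sub, inv_smul_smul₀ hmpos.ne']
  rw [heq, norm_smul, norm_inv, Real.norm_of_nonneg hmpos.le]
  have hinv : (postMass N π Y)⁻¹ ≤ 4 / c := by
    rw [inv_le_comm₀ hmpos (by positivity), inv_div]
    exact hmlow.le
  have h3 : ‖(a - π Y • G Y) - (postMass N π Y - π Y) • G Y‖ ≤ C₂ / N + C₁ / N * b := by
    refine (norm_sub_le _ _).trans (add_le_add ha ?_)
    rw [norm_smul, Real.norm_eq_abs]
    exact mul_le_mul hm hY'.2.1.le (norm_nonneg _) (by positivity)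
  calc _ ≤ 4 / c * (C₂ / N + C₁ / N * b) := by gcongr
    _ = _ := by ring

end GaussianIntegrablePrior

end

/-! ### Expansion of the risk -/

section

variable {n p : ℕ}

theorem tendsto_inv_sqrt_natCast : Tendsto (fun N : ℕ => (√(N : ℝ))⁻¹) atTop (𝓝 0) :=
  tendsto_inv_atTop_zero.comp (Real.tendsto_sqrt_atTop.comp tendsto_natCast_atTop_atTop)

theorem tendsto_norm_inv_sqrt_smul (x : MatSpace n p) :
    Tendsto (fun N : ℕ => ‖(√(N : ℝ))⁻¹ • x‖) atTop (𝓝 0) := by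
  simpa using (tendsto_inv_sqrt_natCast.smul_const x).norm

theorem add_inv_sqrt_smul_mem_ball {N : ℕ} {M x : MatSpace n p} {r : ℝ}
    (h : ‖(√(N : ℝ))⁻¹ • x‖ < r) : M + (√(N : ℝ))⁻¹ • x ∈ Metric.ball M r := by
  rwa [Metric.mem_ball, dist_eq_norm, add_sub_cancel_left]

theorem integral_stdDensity_mul_quadratic (A : MatSpace n p →L[ℝ] MatSpace n p) (c : ℝ) :
    ∫ x, stdDensity x * (2 * inner ℝ x (A x) + c) =
      2 * ∑ i, A (EuclideanSpace.single i 1) i + c := by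
  have hi1 : Integrable fun x : MatSpace n p => 2 * (stdDensity x * inner ℝ x (A x)) := by
    refine (integrable_stdDensity_smul_of_le (f := fun x : MatSpace n p => (inner ℝ x (A x) : ℝ))
      (by fun_prop) ‖A‖ 2 fun x => ?_).const_mul 2
    have h0 := norm_nonneg x
    calc _ ≤ ‖x‖ * ‖A x‖ := norm_inner_le_norm _ _
      _ ≤ ‖x‖ * (‖A‖ * ‖x‖) := by gcongr; exact A.le_opNorm x
      _ = ‖A‖ * ‖x‖ ^ 2 := by ring
      _ ≤ _ := by gcongr; linarith
  have hi2 : Integrable fun x : MatSpace n p => c * stdDensity x := by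
    simpa using (integrable_stdDensity_mul_pow (n := n) (p := p) 0).const_mul c
  have h1 : ∀ x : MatSpace n p, stdDensity x * (2 * inner ℝ x (A x) + c) =
      2 * (stdDensity x * inner ℝ x (A x)) + c * stdDensity x := fun x => by ring
  simp only [h1]
  rw [integral_add hi1 hi2, integral_const_mul, integral_const_mul, integral_stdDensity,
    integral_stdDensity_mul_inner, mul_one]

/-- The integrand of the second-order term of the risk. -/
def riskIntegrand (N : ℕ) (π : MatSpace n p → ℝ) (M g x : MatSpace n p) : ℝ :=
  2 * inner ℝ x (√(N : ℝ) • (postScore N π (M + (√(N : ℝ))⁻¹ • x) - g)) +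
    ‖postScore N π (M + (√(N : ℝ))⁻¹ • x)‖ ^ 2

theorem tendsto_riskIntegrand {π : MatSpace n p → ℝ} {M₀ : MatSpace n p}
    {G : MatSpace n p → MatSpace n p}
    {A : MatSpace n p →L[ℝ] MatSpace n p} (hA : HasFDerivAt G A M₀)
    {r C₁ : ℝ} (hr0 : 0 < r)
    (hscore : ∀ᶠ N : ℕ in atTop, ∀ Y ∈ Metric.ball M₀ r, ‖postScore N π Y - G Y‖ ≤ C₁ / N)
    (x : MatSpace n p) :
    Tendsto (fun N : ℕ => riskIntegrand N π M₀ (G M₀) x) atTop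
      (𝓝 (2 * inner ℝ x (A x) + ‖G M₀‖ ^ 2)) := by
  have h1 : Tendsto (fun N : ℕ => √(N : ℝ) • (postScore N π (M₀ + (√(N : ℝ))⁻¹ • x) -
      G (M₀ + (√(N : ℝ))⁻¹ • x))) atTop (𝓝 0) := by
    refine squeeze_zero_norm' (a := fun N : ℕ => C₁ * (√(N : ℝ))⁻¹) ?_
      (by simpa using tendsto_inv_sqrt_natCast.const_mul C₁)
    filter_upwards [hscore, eventually_ge_atTop 1,
      (tendsto_norm_inv_sqrt_smul x).eventually (gt_mem_nhds hr0)] with N hsc hN hx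
    have hs := sqrt_natCast_pos hN
    have hss : √(N : ℝ) * √(N : ℝ) = N := Real.mul_self_sqrt (Nat.cast_nonneg N)
    have h2 := hsc _ (add_inv_sqrt_smul_mem_ball hx)
    rw [norm_smul, Real.norm_of_nonneg hs.le]
    calc _ ≤ √(N : ℝ) * (C₁ / N) := by gcongr
      _ = √(N : ℝ) * (C₁ / (√(N : ℝ) * √(N : ℝ))) := by rw [hss]
      _ = _ := by field_simp
  have h3 : Tendsto (fun N : ℕ => √(N : ℝ) • (G (M₀ + (√(N : ℝ))⁻¹ • x) - G M₀)) atTop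
      (𝓝 (A x)) := by
    refine hA.lim x (l := atTop) (c := fun N : ℕ => √(N : ℝ)) ?_
    have := Real.tendsto_sqrt_atTop.comp (tendsto_natCast_atTop_atTop (R := ℝ))
    exact tendsto_norm_atTop_atTop.comp this
  have h4 : Tendsto (fun N : ℕ => √(N : ℝ) • (postScore N π (M₀ + (√(N : ℝ))⁻¹ • x) - G M₀))
      atTop (𝓝 (A x)) := by
    have h5 := h1.add h3
    rw [zero_add] at h5
    refine h5.congr fun N => ?_
    rw [← smul_add, sub_add_sub_cancel]
  have h6 : Tendsto (fun N : ℕ => postScore N π (M₀ + (√(N : ℝ))⁻¹ • x)) atTop (𝓝 (G M₀)) := by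
    have h7 := (tendsto_inv_sqrt_natCast.smul h4).add_const (G M₀)
    rw [zero_smul, zero_add] at h7
    refine h7.congr' ?_
    filter_upwards [eventually_ge_atTop 1] with N hN
    rw [inv_smul_smul₀ (sqrt_natCast_pos hN).ne', sub_add_cancel]
  exact ((tendsto_const_nhds.inner h4).const_mul 2).add (h6.norm.pow 2)

namespace GaussianIntegrablePrior

variable {π : MatSpace n p → ℝ} (hπ : GaussianIntegrablePrior π)
include hπ

/-- The risk expansion. The constant vector `g` is free, because the standard normal law is
centered. -/
theorem sq_mul_risk_sub_eq {N : ℕ} (hN : 1 ≤ N) (M g : MatSpace n p) :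
    (N : ℝ) ^ 2 * (risk N (bayesEstimator N π) M - (n * p : ℕ) / N) =
      ∫ x, stdDensity x * riskIntegrand N π M g x := by
  have hN0 : (0 : ℝ) < N := by exact_mod_cast hN
  have hs := sqrt_natCast_pos hN
  have hss : √(N : ℝ) ^ 2 = N := Real.sq_sqrt (Nat.cast_nonneg N)
  have hfin := hπ.finiteRisk hN M
  rw [FiniteRisk, integrable_normalLaw hN] at hfin
  have hi1 := hfin.const_mul ((N : ℝ) ^ 2)
  have hi2 : Integrable fun x : MatSpace n p => N * (stdDensity x * ‖x‖ ^ 2) := by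
    refine (integrable_stdDensity_smul_of_le (f := fun x : MatSpace n p => ‖x‖ ^ 2) (by fun_prop)
      1 2 fun x => ?_).const_mul _
    rw [norm_pow, norm_norm, one_mul]
    gcongr
    linarith
  have hi3 : Integrable fun x : MatSpace n p => 2 * √(N : ℝ) * (stdDensity x * inner ℝ x g) := by
    refine (integrable_stdDensity_smul_of_le (f := fun x : MatSpace n p => (inner ℝ x g : ℝ))
      (by fun_prop) ‖g‖ 1 fun x => ?_).const_mul _
    rw [pow_one]
    calc _ ≤ ‖x‖ * ‖g‖ := norm_inner_le_norm _ _
      _ = ‖g‖ * ‖x‖ := mul_comm _ _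
      _ ≤ _ := by gcongr; linarith
  have hodd : ∫ x : MatSpace n p, stdDensity x * inner ℝ x g = 0 :=
    integral_eq_zero_of_odd fun x => by simp
  have hpt : ∀ x : MatSpace n p, stdDensity x * riskIntegrand N π M g x =
      (N : ℝ) ^ 2 * (stdDensity x • ‖bayesEstimator N π (M + (√(N : ℝ))⁻¹ • x) - M‖ ^ 2) -
        N * (stdDensity x * ‖x‖ ^ 2) - 2 * √(N : ℝ) * (stdDensity x * inner ℝ x g) := by
    intro x
    rw [hπ.bayesEstimator_eq hN, riskIntegrand]
    set S := postScore N π (M + (√(N : ℝ))⁻¹ • x)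
    rw [add_assoc, add_sub_cancel_left, norm_add_sq_real, norm_inv_sqrt_smul_sq, norm_smul,
      Real.norm_of_nonneg (by positivity), inner_smul_left, inner_smul_right, inner_smul_right,
      inner_sub_right, conj_trivial, smul_eq_mul]
    have h1 : (N : ℝ) ^ 2 * ((√(N : ℝ))⁻¹ * ((N : ℝ)⁻¹ * inner ℝ x S)) =
        √(N : ℝ) * inner ℝ x S := by
      have : (N : ℝ) * (√(N : ℝ))⁻¹ = √(N : ℝ) := by
        rw [mul_inv_eq_iff_eq_mul₀ hs.ne', ← sq, hss]
      calc _ = ((N : ℝ) * (√(N : ℝ))⁻¹) * ((N : ℝ) * (N : ℝ)⁻¹) * inner ℝ x S := by ring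
        _ = _ := by rw [this, mul_inv_cancel₀ hN0.ne', mul_one]
    have h2 : (N : ℝ) ^ 2 * (‖x‖ ^ 2 / N) = N * ‖x‖ ^ 2 := by field_simp
    have h3 : (N : ℝ) ^ 2 * ((N : ℝ)⁻¹ * ‖S‖) ^ 2 = ‖S‖ ^ 2 := by field_simp
    linear_combination (-2 * stdDensity x) * h1 - stdDensity x * h2 - stdDensity x * h3
  have hi12 : Integrable fun x => (N : ℝ) ^ 2 *
      (stdDensity x • ‖bayesEstimator N π (M + (√(N : ℝ))⁻¹ • x) - M‖ ^ 2) -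
        N * (stdDensity x * ‖x‖ ^ 2) := hi1.sub hi2
  simp only [hpt]
  rw [integral_sub hi12 hi3, integral_sub hi1 hi2, integral_const_mul, integral_const_mul,
    integral_const_mul, hodd, integral_stdDensity_mul_norm_sq, risk, integral_normalLaw _ hN]
  field_simp
  ring

/-- The integrand of the risk is dominated by a polynomial. Where the perturbation leaves the ball
on which the score converges, `N` itself is at most a multiple of `‖x‖ ^ 2`, so that the crude
global bound on the score is enough. -/
theorem exists_abs_riskIntegrand_le {M₀ : MatSpace n p} {G : MatSpace n p → MatSpace n p}
    {r C₁ C₃ : ℝ} (hr0 : 0 < r) (hC₁ : 0 ≤ C₁) (hC₃ : 0 ≤ C₃)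
    (hscore : ∀ᶠ N : ℕ in atTop, ∀ Y ∈ Metric.ball M₀ r, ‖postScore N π Y - G Y‖ ≤ C₁ / N)
    (hlip : ∀ Y ∈ Metric.ball M₀ r, ‖G Y - G M₀‖ ≤ C₃ * ‖Y - M₀‖) :
    ∃ D : ℝ, ∀ᶠ N : ℕ in atTop, ∀ x : MatSpace n p,
      |riskIntegrand N π M₀ (G M₀) x| ≤ D * (1 + ‖x‖) ^ 12 := by
  obtain ⟨C₂, hC₂, hglob⟩ := hπ.exists_norm_postScore_le
  set b := ‖G M₀‖ with hb
  set K := C₁ + C₃ with hK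
  set Q := C₂ * (1 + ‖M₀‖) ^ 2 / r ^ 4 with hQ
  have hQ0 : 0 ≤ Q := by positivity
  set D := (2 * K + (b + K) ^ 2) + (2 * (1 / r ^ 2) * (Q + b) + Q ^ 2) with hD
  refine ⟨D, ?_⟩
  filter_upwards [hscore, eventually_ge_atTop 1] with N hsc hN x
  have hN1 : (1 : ℝ) ≤ N := by exact_mod_cast hN
  have hN0 : (0 : ℝ) < N := by linarith
  have hs := sqrt_natCast_pos hN
  have hss : √(N : ℝ) * √(N : ℝ) = N := Real.mul_self_sqrt (Nat.cast_nonneg N)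
  have hs1 : 1 ≤ √(N : ℝ) := Real.one_le_sqrt.2 hN1
  set S := postScore N π (M₀ + (√(N : ℝ))⁻¹ • x) with hS
  set t := 1 + ‖x‖ with ht
  have ht1 : 1 ≤ t := by linarith [norm_nonneg x]
  have hxt : ‖x‖ ≤ t := by linarith
  have habs : |riskIntegrand N π M₀ (G M₀) x| ≤
      2 * (t * (√(N : ℝ) * ‖S - G M₀‖)) + ‖S‖ ^ 2 := by
    rw [riskIntegrand]
    refine (abs_add_le _ _).trans ?_
    rw [abs_mul, abs_two, abs_of_nonneg (sq_nonneg ‖S‖)]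
    gcongr
    refine (abs_real_inner_le_norm _ _).trans ?_
    rw [norm_smul, Real.norm_of_nonneg hs.le]
    gcongr
  refine habs.trans ?_
  rcases lt_or_ge ‖(√(N : ℝ))⁻¹ • x‖ r with h | h
  · have h1 := hsc _ (add_inv_sqrt_smul_mem_ball h)
    have h2 := hlip _ (add_inv_sqrt_smul_mem_ball h)
    rw [add_sub_cancel_left, norm_smul, Real.norm_of_nonneg (by positivity)] at h2
    have h3 : √(N : ℝ) * ‖S - G M₀‖ ≤ K * t := by
      have h4 : ‖S - G M₀‖ ≤ C₁ / N + C₃ * ((√(N : ℝ))⁻¹ * ‖x‖) := by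
        refine (norm_sub_le_norm_sub_add_norm_sub S (G (M₀ + (√(N : ℝ))⁻¹ • x)) _).trans ?_
        exact add_le_add h1 h2
      have h5 : √(N : ℝ) * (C₁ / N) ≤ C₁ := by
        calc _ ≤ (N : ℝ) * (C₁ / N) := by gcongr; nlinarith
          _ = C₁ := by field_simp
      have h6 : √(N : ℝ) * (C₃ * ((√(N : ℝ))⁻¹ * ‖x‖)) = C₃ * ‖x‖ := by field_simp
      calc _ ≤ √(N : ℝ) * (C₁ / N + C₃ * ((√(N : ℝ))⁻¹ * ‖x‖)) := by gcongr
        _ = √(N : ℝ) * (C₁ / N) + C₃ * ‖x‖ := by rw [mul_add, h6]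
        _ ≤ C₁ * t + C₃ * t :=
          add_le_add (h5.trans (le_mul_of_one_le_right hC₁ ht1)) (by gcongr)
        _ = K * t := by rw [hK]; ring
    have h7 : ‖S‖ ≤ (b + K) * t := by
      have h8 : ‖S‖ ≤ ‖S - G M₀‖ + b := by
        simpa using norm_add_le (S - G M₀) (G M₀)
      have h9 : ‖S - G M₀‖ ≤ √(N : ℝ) * ‖S - G M₀‖ := le_mul_of_one_le_left (norm_nonneg _) hs1
      have h10 : b ≤ b * t := le_mul_of_one_le_right (norm_nonneg _) ht1
      linarith
    have hK0 : 0 ≤ K := by positivity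
    have hb0 : 0 ≤ b := norm_nonneg _
    calc _ ≤ 2 * (t * (K * t)) + ((b + K) * t) ^ 2 := by gcongr
      _ = (2 * K + (b + K) ^ 2) * t ^ 2 := by ring
      _ ≤ D * t ^ 12 := by
        gcongr
        · rw [hD]
          have : 0 ≤ 2 * (1 / r ^ 2) * (Q + b) + Q ^ 2 := by positivity
          linarith
        · norm_num
  · have h1 := pow_le_pow_left₀ hr0.le h 2
    rw [norm_inv_sqrt_smul_sq, le_div_iff₀ hN0] at h1
    have hNt : (N : ℝ) ≤ 1 / r ^ 2 * t ^ 2 := by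
      rw [one_div, inv_mul_eq_div, le_div_iff₀ (by positivity), mul_comm]
      exact h1.trans (by gcongr)
    have hsN : √(N : ℝ) ≤ 1 / r ^ 2 * t ^ 2 :=
      le_trans (by nlinarith) hNt
    have h2 : ‖S‖ ≤ Q * t ^ 6 := by
      calc ‖S‖ ≤ C₂ * (N : ℝ) ^ 2 * (1 + ‖M₀‖) ^ 2 * t ^ 2 := hglob N hN M₀ x
        _ ≤ C₂ * (1 / r ^ 2 * t ^ 2) ^ 2 * (1 + ‖M₀‖) ^ 2 * t ^ 2 := by gcongr
        _ = Q * t ^ 6 := by rw [hQ]; ring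
    have hb0 : 0 ≤ b := norm_nonneg _
    have h3 : ‖S - G M₀‖ ≤ (Q + b) * t ^ 6 := by
      have : b ≤ b * t ^ 6 := le_mul_of_one_le_right hb0 (one_le_pow₀ ht1)
      linarith [norm_sub_le S (G M₀)]
    calc _ ≤ 2 * (t * (1 / r ^ 2 * t ^ 2 * ((Q + b) * t ^ 6))) + (Q * t ^ 6) ^ 2 := by gcongr
      _ = 2 * (1 / r ^ 2) * (Q + b) * t ^ 9 + Q ^ 2 * t ^ 12 := by ring
      _ ≤ 2 * (1 / r ^ 2) * (Q + b) * t ^ 12 + Q ^ 2 * t ^ 12 := by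
        gcongr
        · norm_num
      _ = (2 * (1 / r ^ 2) * (Q + b) + Q ^ 2) * t ^ 12 := by ring
      _ ≤ D * t ^ 12 := by
        gcongr
        rw [hD]
        have : 0 ≤ 2 * K + (b + K) ^ 2 := by positivity
        linarith

/-- The second-order term of the risk of a generalized Bayes estimator at a point where the prior
is smooth and positive: twice the Laplacian plus the squared norm of the gradient of `log π`. -/
theorem tendsto_risk {M₀ : MatSpace n p} (hsmooth : ContDiffAt ℝ 3 π M₀) (hpos : 0 < π M₀)
    {G : MatSpace n p → MatSpace n p}
    (hG : ∀ᶠ Y in 𝓝 M₀, HasGradientAt π (π Y • G Y) Y) {A : MatSpace n p →L[ℝ] MatSpace n p}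
    (hA : HasFDerivAt G A M₀) :
    Tendsto (fun N : ℕ => (N : ℝ) ^ 2 * (risk N (bayesEstimator N π) M₀ - (n * p : ℕ) / N)) atTop
      (𝓝 (2 * ∑ i, A (EuclideanSpace.single i 1) i + ‖G M₀‖ ^ 2)) := by
  obtain ⟨r₁, hr₁, C₁, hC₁, hscore⟩ := hπ.exists_postScore_sub_le hsmooth hpos hG hA.continuousAt
  obtain ⟨C₃, hC₃, hlip⟩ := hA.isBigO_sub.exists_pos
  obtain ⟨r₂, hr₂, hlip⟩ := Metric.eventually_nhds_iff_ball.1 hlip.bound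
  have hr0 : 0 < min r₁ r₂ := lt_min hr₁ hr₂
  have hscore' := hscore.mono fun N h Y hY =>
    h Y (Metric.ball_subset_ball (min_le_left r₁ r₂) hY)
  have hlim := tendsto_riskIntegrand hA hr0 hscore'
  obtain ⟨D, hbound⟩ := hπ.exists_abs_riskIntegrand_le hr0 hC₁ hC₃.le hscore'
    fun Y hY => hlip Y (Metric.ball_subset_ball (min_le_right r₁ r₂) hY)
  have hmeas : ∀ N : ℕ, Measurable fun x => riskIntegrand N π M₀ (G M₀) x := fun N => by
    have hm := hπ.measurable_postScore N
    unfold riskIntegrand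
    fun_prop
  have hmain : Tendsto (fun N : ℕ => ∫ x, stdDensity x * riskIntegrand N π M₀ (G M₀) x) atTop
      (𝓝 (∫ x, stdDensity x * (2 * inner ℝ x (A x) + ‖G M₀‖ ^ 2))) := by
    refine tendsto_integral_filter_of_dominated_convergence
      (fun x => D * (stdDensity x * (1 + ‖x‖) ^ 12))
      (Eventually.of_forall fun N => ?_) ?_
      ((integrable_stdDensity_mul_pow 12).const_mul D)
      (ae_of_all _ fun x => (hlim x).const_mul _)
    · have := hmeas N
      exact Measurable.aestronglyMeasurable (by fun_prop)
    · filter_upwards [hbound] with N hN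
      refine ae_of_all _ fun x => ?_
      rw [norm_mul, Real.norm_of_nonneg (stdDensity_pos x).le, Real.norm_eq_abs]
      calc _ ≤ stdDensity x * (D * (1 + ‖x‖) ^ 12) :=
            mul_le_mul_of_nonneg_left (hN x) (stdDensity_pos x).le
        _ = _ := by ring
  rw [← integral_stdDensity_mul_quadratic]
  refine hmain.congr' ?_
  filter_upwards [eventually_ge_atTop 1] with N hN
  exact (hπ.sq_mul_risk_sub_eq hN M₀ (G M₀)).symm

end GaussianIntegrablePrior

theorem gaussianIntegrablePrior_priorMSVS1 (hnp : p + 1 < n) {γ : ℝ} (hγ₀ : 0 ≤ γ)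
    (hγ : γ < (p : ℝ) ^ 2 + p) : GaussianIntegrablePrior (priorMSVS1 γ : MatSpace n p → ℝ) where
  measurable := measurable_priorMSVS1 γ
  nonneg := priorMSVS1_nonneg γ
  integrable := integrable_priorMSVS1_mul_exp hnp hγ₀ hγ (by norm_num)
  exists_ball_le := by
    obtain ⟨M, hM⟩ := exists_det_gram_ne_zero hnp
    have hp := pos_of_sq_add_self_pos hγ₀ hγ
    have hpos := priorMSVS1_pos hp γ hM
    obtain ⟨ρ, hρ, h⟩ := Metric.eventually_nhds_iff_ball.1
      ((contDiffAt_priorMSVS1 hp γ hM).continuousAt.eventually (lt_mem_nhds (half_lt_self hpos)))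
    exact ⟨M, ρ, hρ, _, half_pos hpos, fun Y hY => (h Y hY).le⟩

theorem tendsto_risk_sub_risk (hnp : p + 1 < n) {γ : ℝ} (hγ₀ : 0 ≤ γ)
    (hγ : γ < (p : ℝ) ^ 2 + p) {M : MatSpace n p} (hM : (gram M).det ≠ 0) :
    Tendsto (fun N : ℕ => (N : ℝ) ^ 2 * (risk N (bayesEstimator N (priorMSVS1 γ)) M -
      risk N (bayesEstimator N priorSVS) M)) atTop
      (𝓝 (γ * (γ - 2 * (p : ℝ) ^ 2 - 2 * p + 4) / (gram M).trace)) := by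
  have hp := pos_of_sq_add_self_pos hγ₀ hγ
  have hM0 := ne_zero_of_det_gram_ne_zero hp hM
  have hMn := norm_pos_iff.2 hM0
  obtain ⟨A₀, hA₀⟩ := differentiableAt_gradLogSVS hp hM
  obtain ⟨A₁, hA₁, hA₁v⟩ := hasFDerivAt_div_norm_sq_smul hM0 γ
  have h₁ := (gaussianIntegrablePrior_priorMSVS1 (n := n) hnp hγ₀ hγ).tendsto_risk
    (contDiffAt_priorMSVS1 hp γ hM) (priorMSVS1_pos hp γ hM) (G := gradLogMSVS1 γ)
    ((eventually_det_gram_ne_zero hM).mono fun Y hY => hasGradientAt_priorMSVS1 hp γ hY)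
    (hA₀.sub hA₁)
  have h₀ := (gaussianIntegrablePrior_priorMSVS1 (n := n) (γ := 0) hnp le_rfl
    (by positivity)).tendsto_risk (contDiffAt_priorMSVS1 hp 0 hM) (priorMSVS1_pos hp 0 hM)
    (G := gradLogSVS)
    ((eventually_det_gram_ne_zero hM).mono fun Y hY => by
      rw [priorMSVS1_zero]; exact hasGradientAt_priorSVS hp hY) hA₀
  rw [priorMSVS1_zero] at h₀
  have hsum := sum_div_norm_sq_apply hM0 γ hA₁v
  have hnorm : ‖gradLogMSVS1 γ M‖ ^ 2 = ‖gradLogSVS M‖ ^ 2 +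
      2 * (γ / ‖M‖ ^ 2) * (p * (n - p - 1)) + γ ^ 2 / ‖M‖ ^ 2 := by
    rw [gradLogMSVS1, norm_sub_sq_real, inner_smul_right, inner_gradLogSVS hp hM, norm_smul,
      mul_pow, Real.norm_eq_abs, sq_abs]
    field_simp
    ring
  convert! (h₁.sub h₀).congr fun N => ?_ using 2
  · simp only [_root_.sub_apply, PiLp.sub_apply, Finset.sum_sub_distrib, hsum, hnorm,
      ← norm_sq_eq_trace_gram, Fintype.card_prod, Fintype.card_fin]
    push_cast
    field_simp
    ring
  · ring

theorem mul_sub_div_trace_neg (hp : 2 ≤ p) {γ : ℝ} (hγ₀ : 0 < γ) (hγ : γ < (p : ℝ) ^ 2 + p)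
    {M : MatSpace n p} (hM : M ≠ 0) :
    γ * (γ - 2 * (p : ℝ) ^ 2 - 2 * p + 4) / (gram M).trace < 0 := by
  have hp' : (2 : ℝ) ≤ p := by exact_mod_cast hp
  rw [← norm_sq_eq_trace_gram]
  refine div_neg_of_neg_of_pos (mul_neg_of_pos_of_neg hγ₀ ?_) (pow_pos (norm_pos_iff.2 hM) 2)
  nlinarith

end

end DoubleShrinkage

end

theorem theorem2 (n p : ℕ) (hnp : p + 1 < n) (γ : ℝ) (hγ₀ : 0 ≤ γ)
    (hγ : γ < (p : ℝ) ^ 2 + (p : ℝ)) :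
    -- both generalized Bayes estimators exist
    (∀ N : ℕ, 1 ≤ N →
      DoubleShrinkage.BayesWellDefined (n := n) (p := p) N DoubleShrinkage.priorSVS ∧
      DoubleShrinkage.BayesWellDefined (n := n) (p := p) N (DoubleShrinkage.priorMSVS1 γ)) ∧
    -- their risks are finite and the scaled risk difference converges
    (∀ M ∈ DoubleShrinkage.fullRank n p,
      (∀ N : ℕ, 1 ≤ N →
        DoubleShrinkage.FiniteRisk N
          (DoubleShrinkage.bayesEstimator N DoubleShrinkage.priorSVS) M ∧
        DoubleShrinkage.FiniteRisk N
          (DoubleShrinkage.bayesEstimator N (DoubleShrinkage.priorMSVS1 γ)) M) ∧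
      Tendsto
        (fun N : ℕ => (N : ℝ) ^ 2 *
          (DoubleShrinkage.risk N
              (DoubleShrinkage.bayesEstimator N (DoubleShrinkage.priorMSVS1 γ)) M -
            DoubleShrinkage.risk N
              (DoubleShrinkage.bayesEstimator N DoubleShrinkage.priorSVS) M))
        atTop
        (𝓝 (γ * (γ - 2 * (p : ℝ) ^ 2 - 2 * (p : ℝ) + 4) /
          (DoubleShrinkage.gram M).trace))) ∧
    -- asymptotic domination
    (2 ≤ p → 0 < γ →
      DoubleShrinkage.AsymptoticallyDominates
        (fun N => DoubleShrinkage.bayesEstimator N (DoubleShrinkage.priorMSVS1 γ))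
        (fun N => DoubleShrinkage.bayesEstimator N DoubleShrinkage.priorSVS)
        (DoubleShrinkage.fullRank n p)) := by
  have hp := DoubleShrinkage.pos_of_sq_add_self_pos hγ₀ hγ
  have hMSVS := DoubleShrinkage.gaussianIntegrablePrior_priorMSVS1 (n := n) hnp hγ₀ hγ
  have hSVS := DoubleShrinkage.gaussianIntegrablePrior_priorMSVS1 (n := n) (p := p) (γ := 0) hnp
    le_rfl (by positivity)
  rw [DoubleShrinkage.priorMSVS1_zero] at hSVS
  refine ⟨fun N hN => ⟨hSVS.bayesWellDefined hN, hMSVS.bayesWellDefined hN⟩, fun M hM =>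
    ⟨fun N hN => ⟨hSVS.finiteRisk hN M, hMSVS.finiteRisk hN M⟩, ?_⟩, fun hp2 hγpos M hM => ?_⟩
  · exact DoubleShrinkage.tendsto_risk_sub_risk hnp hγ₀ hγ
      (DoubleShrinkage.det_gram_ne_zero_of_mem_fullRank hM)
  · have hdet := DoubleShrinkage.det_gram_ne_zero_of_mem_fullRank hM
    exact ⟨_, DoubleShrinkage.mul_sub_div_trace_neg hp2 hγpos hγ
      (DoubleShrinkage.ne_zero_of_det_gram_ne_zero hp hdet),
      DoubleShrinkage.tendsto_risk_sub_risk hnp hγ₀ hγ hdet⟩
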